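/- For integers $k\ge 1$ and $n\ge 2k+1$, the Kneser graph $K(n,k)$ has the $k$-element subsets of $\{1,\dots,n\}$ as its vertices, and two vertices are adjacent if and only if they are disjoint sets. The odd graph is $O_k:=K(2k+1,k)$. For every integer $k\ge 6$, the odd graph $O_k$ has at least $2^{2^{k-6}}$ distinct Hamilton cycles, where a Hamilton cycle is a cycle that visits every vertex exactly once, and two Hamilton cycles are distinct if they have different edge sets. -/

import Mathlib

/-- The Kneser graph `K(n, k)`: its vertices are the `k`-element subsets of an `n`-element set,
and two (distinct) vertices are adjacent if and only if they are disjoint. The requirement of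
distinctness only matters for `k = 0`. -/
def kneserGraph (n k : ℕ) : SimpleGraph {s : Finset (Fin n) // s.card = k} where
  Adj s t := s ≠ t ∧ Disjoint s.1 t.1
  symm := ⟨fun _ _ h => ⟨h.1.symm, h.2.symm⟩⟩
  loopless := ⟨fun _ h => h.1 rfl⟩

/-- The odd graph `O_k = K(2k+1, k)`. -/
abbrev oddGraph (k : ℕ) : SimpleGraph {s : Finset (Fin (2 * k + 1)) // s.card = k} :=
  kneserGraph (2 * k + 1) k

/-- The set of Hamilton cycles of a graph, each cycle being identified with its set of edges
(so that neither the starting vertex nor the direction of traversal is counted). -/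
def SimpleGraph.hamiltonCycles {V : Type*} [DecidableEq V] (G : SimpleGraph V) :
    Set (Set (Sym2 V)) :=
  {E | ∃ (v : V) (p : G.Walk v v), p.IsHamiltonianCycle ∧ p.edgeSet = E}

/-!
Many Hamilton cycles of the odd graph `O_k` arise from a single 2-factor, by joining its cycles in
different ways.

A word of length `2k` with `k` ones stands for the vertex of `O_k` given by the positions of its
ones, a word with `k + 1` ones for the vertex given by the positions of its zeros and the last
element of the ground set. Adding a one to a word is then an edge of `O_k`, and so is complementing
a word with `k` ones. Each Dyck word, i.e. each binary tree `t` with `k` nodes, is the start of a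
path `pt t` to its complement, and these paths cover the words with `k` or `k + 1` ones exactly once
(`exists_pt_eq`, and a count by Catalan numbers). Closing each path by one edge yields a 2-factor
`factor k` with one cycle for each tree.

Cycles of a 2-factor are merged by polygons in which every second edge lies in the 2-factor, these
edges belonging to different cycles: the edges in the 2-factor are deleted, the others are inserted
(`merge_polygon`). If polygons with disjoint edges form a forest on the set of cycles, this
can be done for all of them (`switched_of_forest`), and if the forest connects everything, the
result is a Hamilton cycle (`IsScheme.exists_hamiltonCycle`). The deleted edges can be recovered from
this cycle.

Schemes of such polygons are built by recursion. The path of `u △ v` consists of the reversed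
complemented path of `u`, the path of `v` and two more edges, so that polygons for `u` and for `v`
can be lifted (`isScheme_lifts`). The lifts join all trees `u △ v` with given numbers of nodes in `u`
and in `v`; only trees with two nodes, for which there is no polygon, have to be distinguished. The
remaining components are joined by explicit hexagons and an octagon (`exists_isLinking`). These links
need some path edges that must not have been used before; that these edges are kept free is part of
the induction (`Retained`, `IsLinking.isGood`).

For the count, the schemes lifted to `nil △ v` and to `u △ nil` can be chosen independently, so that
the number of schemes is at least squared in each step. The recursion starts with two schemes for
`k = 6`, given by two choices of the last hexagon (`exists_many_isGood`).
-/

namespace OddGraph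

/-! ### Switching edges in 2-regular graphs -/

section Switching

variable {V : Type*}

/-- Every vertex has exactly two neighbours, so that a finite `H` is a disjoint union of cycles. -/
def TwoRegular (H : SimpleGraph V) : Prop := ∀ v, (H.neighborSet v).ncard = 2

/-- Deletes the edges in `R` and inserts the edges in `A`. -/
def exchange (H : SimpleGraph V) (R A : Set (Sym2 V)) : SimpleGraph V :=
  H.deleteEdges R ⊔ SimpleGraph.fromEdgeSet A

lemma exchange_adj {H : SimpleGraph V} {R A : Set (Sym2 V)} {a b : V} :
    (exchange H R A).Adj a b ↔ (H.Adj a b ∧ s(a, b) ∉ R) ∨ (s(a, b) ∈ A ∧ a ≠ b) := by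
  simp [exchange]

lemma TwoRegular.isCycles {H : SimpleGraph V} (h : TwoRegular H) : H.IsCycles := fun v _ => h v

lemma reachable_of_forall_adj {W : Type*} {G : SimpleGraph V} {H : SimpleGraph W} (f : V → W)
    (hf : ∀ a b, G.Adj a b → H.Reachable (f a) (f b)) {a b : V} (h : G.Reachable a b) :
    H.Reachable (f a) (f b) := by
  obtain ⟨w⟩ := h
  induction w with
  | nil => rfl
  | cons h _ ih => exact (hf _ _ h).trans ih

variable [Finite V]

/-- Replacing the edges `pq` and `p'q'` of two different cycles by `qp'` and `q'p` merges the two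
cycles into one. -/
lemma merge_two {ι : Type*} {H : SimpleGraph V} (h2 : TwoRegular H) (r : V → ι)
    (hr : ∀ a b, H.Adj a b → r a = r b) {p q p' q' : V} (hpq : H.Adj p q) (hpq' : H.Adj p' q')
    (hne : r p ≠ r p') :
    TwoRegular (exchange H {s(p, q), s(p', q')} {s(q, p'), s(q', p)}) ∧
    (∀ a b, H.Reachable a b →
      (exchange H {s(p, q), s(p', q')} {s(q, p'), s(q', p)}).Reachable a b) ∧
    (exchange H {s(p, q), s(p', q')} {s(q, p'), s(q', p)}).Reachable p p' := by
  set H' := exchange H {s(p, q), s(p', q')} {s(q, p'), s(q', p)} with hH'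
  have rq := hr _ _ hpq
  have rq' := hr _ _ hpq'
  have e1 := hpq.ne
  have e2 := hpq'.ne
  have n1 : p ≠ p' := fun h => hne (by rw [h])
  have n2 : p ≠ q' := fun h => hne (by rw [h, rq'])
  have n3 : q ≠ p' := fun h => hne (by rw [rq, h])
  have n4 : q ≠ q' := fun h => hne (by rw [rq, h, rq'])
  have x1 : ¬ H.Adj q p' := fun h => hne (by rw [rq, hr _ _ h])
  have x2 : ¬ H.Adj p q' := fun h => hne (by rw [rq', hr _ _ h])
  -- each of the four vertices loses one neighbour and gains another
  have key : ∀ v x y, H.Adj v x → ¬ H.Adj v y →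
      (∀ b, H'.Adj v b ↔ (H.Adj v b ∧ b ≠ x) ∨ b = y) → (H'.neighborSet v).ncard = 2 := by
    intro v x y hx hy hb
    have : H'.neighborSet v = insert y (H.neighborSet v \ {x}) := by
      ext b
      simp only [SimpleGraph.mem_neighborSet, Set.mem_insert_iff, Set.mem_sdiff,
        Set.mem_singleton_iff, hb]
      tauto
    rw [this, Set.ncard_insert_of_notMem (by simp [hy]) (Set.toFinite _),
      Set.ncard_sdiff_singleton_of_mem (by simpa using hx), h2 v]
  have hreg : TwoRegular H' := by
    intro v
    by_cases v1 : v = p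
    · subst v1
      refine key v q q' hpq x2 fun b => ?_
      rw [hH', exchange_adj]
      simp only [Set.mem_insert_iff, Set.mem_singleton_iff, Sym2.eq_iff]
      grind
    by_cases v2 : v = q
    · subst v2
      refine key v p p' hpq.symm x1 fun b => ?_
      rw [hH', exchange_adj]
      simp only [Set.mem_insert_iff, Set.mem_singleton_iff, Sym2.eq_iff]
      grind
    by_cases v3 : v = p'
    · subst v3
      refine key v q' q hpq' (fun h => x1 h.symm) fun b => ?_
      rw [hH', exchange_adj]
      simp only [Set.mem_insert_iff, Set.mem_singleton_iff, Sym2.eq_iff]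
      grind
    by_cases v4 : v = q'
    · subst v4
      refine key v p' p hpq'.symm (fun h => x2 h.symm) fun b => ?_
      rw [hH', exchange_adj]
      simp only [Set.mem_insert_iff, Set.mem_singleton_iff, Sym2.eq_iff]
      grind
    rw [← h2 v]
    congr 1
    ext b
    simp only [SimpleGraph.mem_neighborSet, hH', exchange_adj, Set.mem_insert_iff,
      Set.mem_singleton_iff, Sym2.eq_iff]
    grind
  -- a cycle minus one edge is still connected, and does not meet the other deleted edge
  have arc : ∀ x y x' y', H.Adj x y → r x ≠ r x' → H.Adj x' y' →
      (∀ b c, H.Adj b c → s(b, c) ≠ s(x, y) → s(b, c) ≠ s(x', y') → H'.Adj b c) →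
      H'.Reachable x y := by
    intro x y x' y' hxy hn hxy' hb
    obtain ⟨w⟩ := h2.isCycles.reachable_deleteEdges hxy
    have : ∀ (b c : V), (H.deleteEdges {s(x, y)}).Walk b c → r b = r x → H'.Reachable b c := by
      intro b c w
      induction w with
      | nil => intro _; rfl
      | @cons b d c hbd _ ih =>
        intro hbx
        rw [SimpleGraph.deleteEdges_adj] at hbd
        have hd : r d = r x := (hr _ _ hbd.1).symm.trans hbx
        refine SimpleGraph.Reachable.trans (hb b d hbd.1 hbd.2 ?_).reachable (ih hd)
        intro h
        rcases Sym2.eq_iff.1 h with ⟨h, -⟩ | ⟨-, h⟩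
        · exact hn (by rw [← h, hbx])
        · exact hn (by rw [← h, hd])
    exact this _ _ w rfl
  have hpq_r : H'.Reachable p q := arc p q p' q' hpq hne hpq' fun b c h h1 h2 => by
    rw [hH', exchange_adj]; left; simp [h, h1, h2]
  have hpq'_r : H'.Reachable p' q' := arc p' q' p q hpq' hne.symm hpq fun b c h h1 h2 => by
    rw [hH', exchange_adj]; left; simp [h, h1, h2]
  refine ⟨hreg, fun a b hab => ?_, hpq_r.trans (SimpleGraph.Adj.reachable ?_)⟩
  · refine reachable_of_forall_adj id (fun a b hab => ?_) hab
    by_cases h1 : s(a, b) = s(p, q)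
    · rcases Sym2.eq_iff.1 h1 with ⟨rfl, rfl⟩ | ⟨rfl, rfl⟩
      exacts [hpq_r, hpq_r.symm]
    by_cases h2 : s(a, b) = s(p', q')
    · rcases Sym2.eq_iff.1 h2 with ⟨rfl, rfl⟩ | ⟨rfl, rfl⟩
      exacts [hpq'_r, hpq'_r.symm]
    refine SimpleGraph.Adj.reachable ?_
    rw [hH', exchange_adj]; left; simp [hab, h1, h2]
  · rw [hH', exchange_adj]; right; simp [n3]

/-- The edges of a polygon that are deleted. -/
def removedEdges (h : List (V × V)) : Set (Sym2 V) := {e | ∃ d ∈ h, e = s(d.1, d.2)}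

/-- The edges joining consecutive members of a list of oriented edges, starting at `q` and ending
at `p`. -/
def chainEdges : V → List (V × V) → V → Set (Sym2 V)
  | q, [], p => {s(q, p)}
  | q, d :: l, p => insert s(q, d.1) (chainEdges d.2 l p)

/-- The edges of a polygon that are inserted: the head of each oriented edge is joined to the tail
of the cyclically next one. -/
def addedEdges : List (V × V) → Set (Sym2 V)
  | [] => ∅
  | d :: l => chainEdges d.2 l d.1

/-- Replacing one edge of each of several different cycles by the other edges of a closed polygon
merges the cycles into one. The polygon has the deleted edges `pq` and the members of `l`, in cyclic
order. -/
lemma merge_polygon {ι : Type*} (p : V) : ∀ (l : List (V × V)) (q : V) (H : SimpleGraph V)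
    (r : V → ι), TwoRegular H → (∀ a b, H.Adj a b → r a = r b) → H.Adj p q →
    (∀ d ∈ l, H.Adj d.1 d.2) → (r p :: l.map fun d => r d.1).Nodup →
    TwoRegular (exchange H (removedEdges ((p, q) :: l)) (chainEdges q l p)) ∧
    (∀ a b, H.Reachable a b →
      (exchange H (removedEdges ((p, q) :: l)) (chainEdges q l p)).Reachable a b) ∧
    (∀ d ∈ l, (exchange H (removedEdges ((p, q) :: l)) (chainEdges q l p)).Reachable p d.1) := by
  classical
  intro l
  induction l with
  | nil =>
    intro q H r h2 hr hpq _ _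
    have : exchange H (removedEdges [(p, q)]) (chainEdges q [] p) = H := by
      ext a b
      rw [exchange_adj]
      simp only [removedEdges, chainEdges, List.mem_singleton, exists_eq_left,
        Set.mem_singleton_iff, Set.mem_ofPred_eq]
      constructor
      · rintro (h | ⟨h, -⟩)
        · exact h.1
        · rcases Sym2.eq_iff.1 h with ⟨rfl, rfl⟩ | ⟨rfl, rfl⟩
          exacts [hpq.symm, hpq]
      · intro h
        by_cases h' : s(a, b) = s(p, q)
        · exact Or.inr ⟨by rw [h', Sym2.eq_swap], h.ne⟩
        · exact Or.inl ⟨h, h'⟩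
    rw [this]
    exact ⟨h2, fun _ _ h => h, by simp⟩
  | cons d l ih =>
    obtain ⟨p', q'⟩ := d
    intro q H r h2 hr hpq hl hnd
    rw [List.forall_mem_cons] at hl
    simp only [List.map_cons, List.nodup_cons, List.mem_cons, not_or] at hnd
    obtain ⟨⟨hne, hpl⟩, hpl', hnd⟩ := hnd
    obtain ⟨hpq', hl⟩ := hl
    -- Switching the first two edges leaves a shorter polygon with the auxiliary edge `q'p`, which
    -- the induction hypothesis deletes again.
    obtain ⟨g1, g2, g3⟩ := merge_two h2 r hr hpq hpq' hne
    set H1 := exchange H {s(p, q), s(p', q')} {s(q, p'), s(q', p)} with hH1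
    have rq := hr _ _ hpq
    have rq' := hr _ _ hpq'
    have hrl : ∀ d ∈ l, r d.1 ≠ r p ∧ r d.1 ≠ r p' := fun d hd =>
      ⟨fun h => hpl (List.mem_map.2 ⟨d, hd, h⟩), fun h => hpl' (List.mem_map.2 ⟨d, hd, h⟩)⟩
    have hrl2 : ∀ d ∈ l, r d.2 ≠ r p ∧ r d.2 ≠ r p' := fun d hd => by
      rw [← hr _ _ (hl d hd)]; exact hrl d hd
    have n1 : p ≠ p' := fun h => hne (by rw [h])
    have n2 : p ≠ q' := fun h => hne (by rw [h, rq'])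
    have n3 : q ≠ p' := fun h => hne (by rw [rq, h])
    have n4 : q ≠ q' := fun h => hne (by rw [rq, h, rq'])
    have x2 : ¬ H.Adj p q' := fun h => hne (by rw [rq', hr _ _ h])
    obtain ⟨k1, k2, k3⟩ := ih q' H1 (fun x => if r x = r p' then r p else r x) g1
      (by
        intro a b hab
        rw [hH1, exchange_adj] at hab
        simp only [Set.mem_insert_iff, Set.mem_singleton_iff, Sym2.eq_iff] at hab
        rcases hab with ⟨h, -⟩ | ⟨(⟨rfl, rfl⟩ | ⟨rfl, rfl⟩) | (⟨rfl, rfl⟩ | ⟨rfl, rfl⟩), -⟩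
        · simp only [hr _ _ h]
        all_goals simp [← rq, ← rq', hne])
      (by rw [hH1, exchange_adj]; right; simp [n2, Sym2.eq_swap])
      (by
        intro d hd
        rw [hH1, exchange_adj]; left
        refine ⟨hl d hd, ?_⟩
        simp only [Set.mem_insert_iff, Set.mem_singleton_iff, Sym2.eq_iff]
        have := hrl d hd
        have := hrl2 d hd
        grind)
      (by
        have : (l.map fun d => if r d.1 = r p' then r p else r d.1) = l.map fun d => r d.1 :=
          List.map_congr_left fun d hd => if_neg (hrl d hd).2
        simp only [hne, if_false, this]
        exact List.nodup_cons.2 ⟨hpl, hnd⟩)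
    have heq : exchange H1 (removedEdges ((p, q') :: l)) (chainEdges q' l p) =
        exchange H (removedEdges ((p, q) :: (p', q') :: l)) (chainEdges q ((p', q') :: l) p) := by
      ext a b
      rw [exchange_adj, hH1, exchange_adj, exchange_adj]
      have hA : s(a, b) = s(p, q') → ¬ H.Adj a b := by
        intro h
        rcases Sym2.eq_iff.1 h with ⟨rfl, rfl⟩ | ⟨rfl, rfl⟩
        exacts [x2, fun h => x2 h.symm]
      have hB : s(a, b) = s(q, p') → (s(a, b) ≠ s(p, q') ∧ ∀ d ∈ l, s(a, b) ≠ s(d.1, d.2)) := by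
        intro h
        rw [h]
        refine ⟨?_, fun d hd h => ?_⟩
        · intro h; rw [Sym2.eq_iff] at h; grind [hpq.ne]
        · have := hrl d hd
          have := hrl2 d hd
          rw [Sym2.eq_iff] at h; grind
      have hC : s(q', p) = s(p, q') := Sym2.eq_swap
      simp only [removedEdges, chainEdges, List.mem_cons, Set.mem_ofPred_eq, Set.mem_insert_iff,
        Set.mem_singleton_iff, exists_eq_or_imp, hC, not_or, not_exists, not_and]
      constructor
      · rintro (⟨⟨h1, h2⟩ | ⟨h1, h2⟩, h3, h4⟩ | h)
        · exact Or.inl ⟨h1, h2.1, h2.2, h4⟩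
        · rcases h1 with h1 | h1
          · exact Or.inr ⟨Or.inl h1, h2⟩
          · exact absurd h1 h3
        · exact Or.inr ⟨Or.inr h.1, h.2⟩
      · rintro (⟨h1, h2, h3, h4⟩ | ⟨h1 | h1, h2⟩)
        · exact Or.inl ⟨Or.inl ⟨h1, h2, h3⟩, fun h => hA h h1, h4⟩
        · exact Or.inl ⟨Or.inr ⟨Or.inl h1, h2⟩, (hB h1).1, fun d hd h => (hB h1).2 d hd h⟩
        · exact Or.inr ⟨h1, h2⟩
    rw [heq] at k1 k2 k3
    refine ⟨k1, fun a b h => k2 a b (g2 a b h), ?_⟩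
    intro d hd
    rcases List.mem_cons.1 hd with rfl | hd
    · exact k2 _ _ g3
    · exact k3 d hd

end Switching

end OddGraph

namespace OddGraph

/-! ### Merging the cycles of a 2-regular graph along a forest of polygons -/

section Forest

variable {α X V : Type*}

/-- `R` relates consecutive members of the list `d :: l ++ [d₀]`. -/
def ChainRel (R : α → α → Prop) : α → List α → α → Prop
  | d, [], d₀ => R d d₀
  | d, d' :: l, d₀ => R d d' ∧ ChainRel R d' l d₀

/-- `R` relates cyclically consecutive members of a list. -/
def Cyclic (R : α → α → Prop) : List α → Prop
  | [] => True
  | d :: l => ChainRel R d l d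

lemma ChainRel.of_mem {R : α → α → Prop} {ends : α → V × V} {x : Sym2 V} :
    ∀ {l : List α} {d d₀ : α}, ChainRel R d l d₀ →
    x ∈ chainEdges (ends d).2 (l.map ends) (ends d₀).1 →
    ∃ e ∈ d :: l, ∃ e' ∈ d₀ :: l, R e e' ∧ x = s((ends e).2, (ends e').1)
  | [], d, d₀, h, hx => ⟨d, by simp, d₀, by simp, h, hx⟩
  | d' :: l, d, d₀, h, hx => by
    rcases hx with hx | hx
    · exact ⟨d, by simp, d', by simp, h.1, hx⟩
    · obtain ⟨e, he, e', he', h'⟩ := ChainRel.of_mem h.2 hx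
      refine ⟨e, List.mem_cons_of_mem _ he, e', ?_, h'⟩
      simp only [List.mem_cons] at he' ⊢
      tauto

/-- The inserted edges of a polygon join cyclically consecutive edges. -/
lemma Cyclic.of_mem {R : α → α → Prop} {ends : α → V × V} {x : Sym2 V} {l : List α}
    (h : Cyclic R l) (hx : x ∈ addedEdges (l.map ends)) :
    ∃ e ∈ l, ∃ e' ∈ l, R e e' ∧ x = s((ends e).2, (ends e').1) := by
  cases l with
  | nil => exact absurd hx (by simp [addedEdges])
  | cons d l => exact ChainRel.of_mem h hx

lemma ChainRel.ne_of_nodup (f : α → X) : ∀ (l : List α) (d d₀ : α), ((d :: l).map f).Nodup →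
    f d₀ ∉ l.map f → (l = [] → f d ≠ f d₀) → ChainRel (fun e e' => f e ≠ f e') d l d₀
  | [], _, _, _, _, h3 => h3 rfl
  | d' :: l, d, d₀, h1, h2, _ => by
    simp only [List.map_cons, List.nodup_cons, List.mem_cons, not_or] at h1 h2
    refine ⟨h1.1.1, ChainRel.ne_of_nodup f l d' d₀ ?_ h2.2 fun _ => Ne.symm h2.1⟩
    simp only [List.map_cons, List.nodup_cons]
    exact h1.2

lemma Cyclic.ne_of_nodup (f : α → X) {l : List α} (h : (l.map f).Nodup) (hl : 2 ≤ l.length) :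
    Cyclic (fun e e' => f e ≠ f e') l := by
  cases l with
  | nil => trivial
  | cons d l =>
    refine ChainRel.ne_of_nodup f l d d h ?_ ?_
    · exact (List.nodup_cons.1 h).1
    · rintro rfl; simp at hl

/-- A function that is constant on each polygon. -/
def ConstOn {Y : Type*} (f : α → Y) (P : Set (List α)) : Prop :=
  ∀ h ∈ P, ∀ e ∈ h, ∀ e' ∈ h, f e = f e'

/-- A set of polygons is a forest if it can be built up one polygon at a time, such that each new
polygon meets pairwise different connected components of the hypergraph of the previous ones. Here
`lab` assigns to an edge the cycle that contains it, and the components are told apart by a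
function `r` that is constant on all previous polygons. -/
inductive Forest (lab : α → X) : Set (List α) → Prop
  | empty : Forest lab ∅
  | insert {P : Set (List α)} {h : List α} (r : X → X) (hP : Forest lab P)
      (hr : ConstOn (fun e => r (lab e)) P) (hh : (h.map fun e => r (lab e)).Nodup) :
      Forest lab (insert h P)

/-- The graph obtained from `H` by switching all polygons in `P`. -/
def switched (H : SimpleGraph V) (ends : α → V × V) (P : Set (List α)) : SimpleGraph V :=
  exchange H {x | ∃ h ∈ P, x ∈ removedEdges (h.map ends)} {x | ∃ h ∈ P, x ∈ addedEdges (h.map ends)}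

lemma mem_removedEdges_map {ends : α → V × V} {h : List α} {x : Sym2 V} :
    x ∈ removedEdges (h.map ends) ↔ ∃ e ∈ h, x = s((ends e).1, (ends e).2) := by
  simp [removedEdges]

/-- Switching a forest of polygons keeps the graph 2-regular and merges the cycles met by each
polygon. -/
theorem switched_of_forest [Finite V] {H : SimpleGraph V} (h2 : TwoRegular H) {c : V → X}
    (hc : ∀ a b, H.Adj a b → c a = c b) {lab : α → X} {ends : α → V × V} {P : Set (List α)}
    (hF : Forest lab P) (hadj : ∀ h ∈ P, ∀ e ∈ h, H.Adj (ends e).1 (ends e).2)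
    (hlab : ∀ h ∈ P, ∀ e ∈ h, c (ends e).1 = lab e) (hlen : ∀ h ∈ P, 2 ≤ h.length)
    (hdis : ∀ h ∈ P, ∀ h' ∈ P, ∀ e ∈ h, ∀ e' ∈ h',
      s((ends e).1, (ends e).2) = s((ends e').1, (ends e').2) → h = h') :
    TwoRegular (switched H ends P) ∧
    (∀ a b, H.Reachable a b → (switched H ends P).Reachable a b) ∧
    (∀ h ∈ P, ∀ e ∈ h, ∀ e' ∈ h,
      (switched H ends P).Reachable (ends e).1 (ends e').1) ∧
    (∀ h ∈ P, ∀ a b, s(a, b) ∈ addedEdges (h.map ends) → c a ≠ c b) ∧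
    (∀ r : X → X, ConstOn (fun e => r (lab e)) P →
      ∀ a b, (switched H ends P).Adj a b → r (c a) = r (c b)) := by
  induction hF with
  | empty =>
    have : switched H ends ∅ = H := by
      ext a b
      simp [switched, exchange_adj]
    rw [this]
    exact ⟨h2, fun _ _ h => h, by simp, by simp, fun r _ a b h => by rw [hc a b h]⟩
  | @insert P h r hP hr hh ih =>
    obtain ⟨i1, i2, i3, i4, i5⟩ := ih (fun h' h'' => hadj h' (Or.inr h''))
      (fun h' h'' => hlab h' (Or.inr h'')) (fun h' h'' => hlen h' (Or.inr h''))
      (fun h' hh' k hk => hdis h' (Or.inr hh') k (Or.inr hk))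
    by_cases hmem : h ∈ P
    · rw [Set.insert_eq_of_mem hmem]
      exact ⟨i1, i2, i3, i4, i5⟩
    have hadj' := hadj h (Or.inl rfl)
    have hlab' := hlab h (Or.inl rfl)
    have hlen' := hlen h (Or.inl rfl)
    have hcyc : Cyclic (fun e e' => lab e ≠ lab e') h := by
      refine Cyclic.ne_of_nodup lab ?_ hlen'
      refine List.Nodup.of_map r ?_
      rwa [List.map_map]
    have hlab2 : ∀ e ∈ h, c (ends e).2 = lab e := fun e he => by
      rw [← hc _ _ (hadj' e he), hlab' e he]
    have hadd : ∀ a b, s(a, b) ∈ addedEdges (h.map ends) → c a ≠ c b := by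
      intro a b hab
      obtain ⟨e, he, e', he', hne, hx⟩ := hcyc.of_mem hab
      rcases Sym2.eq_iff.1 hx with ⟨rfl, rfl⟩ | ⟨rfl, rfl⟩
      · rw [hlab2 e he, hlab' e' he']; exact hne
      · rw [hlab2 e he, hlab' e' he']; exact hne.symm
    have hadjP : ∀ e ∈ h, (switched H ends P).Adj (ends e).1 (ends e).2 := by
      intro e he
      rw [switched, exchange_adj]
      refine Or.inl ⟨hadj' e he, ?_⟩
      rintro ⟨h', hh', hx⟩
      obtain ⟨e', he', hx⟩ := mem_removedEdges_map.1 hx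
      exact hmem (hdis h (Or.inl rfl) h' (Or.inr hh') e he e' he' hx ▸ hh')
    have heq : exchange (switched H ends P) (removedEdges (h.map ends))
        (addedEdges (h.map ends)) = switched H ends (insert h P) := by
      ext a b
      have hA : s(a, b) ∈ removedEdges (h.map ends) →
          ∀ h' ∈ P, s(a, b) ∉ addedEdges (h'.map ends) := by
        intro hx h' hh' hy
        refine i4 h' hh' a b hy ?_
        obtain ⟨e, he, hx⟩ := mem_removedEdges_map.1 hx
        rcases Sym2.eq_iff.1 hx with ⟨rfl, rfl⟩ | ⟨rfl, rfl⟩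
        exacts [hc _ _ (hadj' e he), (hc _ _ (hadj' e he)).symm]
      simp only [switched, exchange_adj, Set.mem_ofPred_eq, Set.mem_insert_iff,
        exists_eq_or_imp]
      constructor
      · rintro (⟨⟨h1, h2⟩ | ⟨h1, h2⟩, h3⟩ | h)
        · exact Or.inl ⟨h1, fun h => h.elim h3 h2⟩
        · exact Or.inr ⟨Or.inr h1, h2⟩
        · exact Or.inr ⟨Or.inl h.1, h.2⟩
      · rintro (⟨h1, h2⟩ | ⟨h1 | h1, h2⟩)
        · exact Or.inl ⟨Or.inl ⟨h1, fun h => h2 (Or.inr h)⟩, fun h => h2 (Or.inl h)⟩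
        · exact Or.inr ⟨h1, h2⟩
        · refine Or.inl ⟨Or.inr ⟨h1, h2⟩, fun hx => ?_⟩
          obtain ⟨h', hh', hy⟩ := h1
          exact hA hx h' hh' hy
    have main : TwoRegular (switched H ends (insert h P)) ∧
        (∀ a b, (switched H ends P).Reachable a b →
          (switched H ends (insert h P)).Reachable a b) ∧
        (∀ e ∈ h, ∀ e' ∈ h,
          (switched H ends (insert h P)).Reachable (ends e).1 (ends e').1) := by
      rw [← heq]
      cases h with
      | nil => simp at hlen'
      | cons d l =>
        obtain ⟨m1, m2, m3⟩ := merge_polygon (ends d).1 (l.map ends) (ends d).2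
          (switched H ends P) (fun a => r (c a)) i1 (i5 r hr) (hadjP d (by simp))
          (by
            intro e he
            obtain ⟨e', he', rfl⟩ := List.mem_map.1 he
            exact hadjP e' (List.mem_cons_of_mem _ he'))
          (by
            rw [List.map_map]
            have : (d :: l).map (fun e => r (lab e)) = r (c (ends d).1) ::
                l.map ((fun d => r (c d.1)) ∘ ends) := by
              rw [List.map_cons, hlab' d (by simp)]
              congr 1
              refine List.map_congr_left fun e he => ?_
              simp [hlab' e (List.mem_cons_of_mem _ he)]
            rwa [← this])
        refine ⟨m1, m2, ?_⟩
        have : ∀ e ∈ d :: l, (exchange (switched H ends P)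
            (removedEdges ((d :: l).map ends)) (addedEdges ((d :: l).map ends))).Reachable
            (ends d).1 (ends e).1 := by
          intro e he
          rcases List.mem_cons.1 he with rfl | he
          · rfl
          · exact m3 _ (List.mem_map.2 ⟨e, he, rfl⟩)
        exact fun e he e' he' => (this e he).symm.trans (this e' he')
    obtain ⟨m1, m2, m3⟩ := main
    refine ⟨m1, fun a b h => m2 a b (i2 a b h), ?_, ?_, ?_⟩
    · rintro h' (rfl | hh') e he e' he'
      · exact m3 e he e' he'
      · exact m2 _ _ (i3 h' hh' e he e' he')
    · rintro h' (rfl | hh')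
      · exact hadd
      · exact i4 h' hh'
    · intro r' hr' a b hab
      rw [← heq, exchange_adj] at hab
      rcases hab with ⟨hab, -⟩ | ⟨hab, -⟩
      · exact i5 r' (fun h' hh' => hr' h' (Or.inr hh')) a b hab
      · obtain ⟨e, he, e', he', -, hx⟩ := hcyc.of_mem hab
        have := hr' h (Or.inl rfl) e he e' he'
        rcases Sym2.eq_iff.1 hx with ⟨rfl, rfl⟩ | ⟨rfl, rfl⟩
        · rw [hlab2 e he, hlab' e' he']; exact this
        · rw [hlab2 e he, hlab' e' he']; exact this.symm

/-- A forest of polygons that connects all labels yields a connected graph. -/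
theorem connected_of_forest [Finite V] [Nonempty V] {H : SimpleGraph V} (h2 : TwoRegular H)
    {c : V → X} (hc : ∀ a b, H.Adj a b → c a = c b) (hc' : ∀ a b, c a = c b → H.Reachable a b)
    {lab : α → X} {ends : α → V × V} {P : Set (List α)}
    (hF : Forest lab P) (hadj : ∀ h ∈ P, ∀ e ∈ h, H.Adj (ends e).1 (ends e).2)
    (hlab : ∀ h ∈ P, ∀ e ∈ h, c (ends e).1 = lab e) (hlen : ∀ h ∈ P, 2 ≤ h.length)
    (hdis : ∀ h ∈ P, ∀ h' ∈ P, ∀ e ∈ h, ∀ e' ∈ h',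
      s((ends e).1, (ends e).2) = s((ends e').1, (ends e').2) → h = h')
    (hconn : ∀ f : X → Prop, ConstOn (fun e => f (lab e)) P → ∀ a b, f (c a) = f (c b)) :
    (switched H ends P).Connected := by
  obtain ⟨-, i2, i3, -, -⟩ := switched_of_forest h2 hc hF hadj hlab hlen hdis
  have : ∀ a b, (switched H ends P).Reachable a b := by
    intro a b
    have := hconn (fun x => ∀ d, c d = x → (switched H ends P).Reachable a d) ?_ a b
    · exact (cast this fun d hd => i2 _ _ (hc' _ _ hd.symm)) b rfl
    · have aux : ∀ h ∈ P, ∀ e ∈ h, ∀ e' ∈ h,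
          (∀ d, c d = lab e → (switched H ends P).Reachable a d) →
          ∀ d, c d = lab e' → (switched H ends P).Reachable a d := by
        intro h hh e he e' he' H1 d hd
        refine (H1 _ (hlab h hh e he)).trans ((i3 h hh e he e' he').trans (i2 _ _ (hc' _ _ ?_)))
        rw [hd, hlab h hh e' he']
      exact fun h hh e he e' he' => propext ⟨aux h hh e he e' he', aux h hh e' he' e he⟩
  exact ⟨this⟩

/-- A connected 2-regular spanning subgraph is a Hamilton cycle. -/
theorem exists_isHamiltonianCycle [DecidableEq V] [Finite V] [Nonempty V] {G H : SimpleGraph V}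
    (hle : H ≤ G) (h2 : TwoRegular H) (hconn : H.Connected) :
    H.edgeSet ∈ G.hamiltonCycles := by
  classical
  have := Fintype.ofFinite V
  obtain ⟨v⟩ := ‹Nonempty V›
  obtain ⟨p, hp, hv⟩ := h2.isCycles.exists_cycle_toSubgraph_verts_eq_connectedComponentSupp
    (c := H.connectedComponentMk v) (v := v) rfl (Set.nonempty_of_ncard_ne_zero (by simp [h2 v]))
  have hsupp : ∀ w, w ∈ p.support := by
    intro w
    rw [← SimpleGraph.Walk.mem_verts_toSubgraph, hv]
    exact SimpleGraph.ConnectedComponent.sound (hconn.preconnected w v)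
  have hham : p.IsHamiltonianCycle := by
    rw [SimpleGraph.Walk.isHamiltonianCycle_iff_isCycle_and_support_count_tail_eq_one]
    refine ⟨hp, fun a => ?_⟩
    refine List.count_eq_one_of_mem hp.support_nodup ?_
    by_cases ha : a = v
    · subst ha
      exact SimpleGraph.Walk.end_mem_tail_support hp.not_nil
    · have := hsupp a
      rw [← SimpleGraph.Walk.cons_tail_support] at this
      exact (List.mem_cons.1 this).resolve_left ha
  refine ⟨v, p.mapLe hle, ?_, ?_⟩
  · exact hham.map (f := SimpleGraph.Hom.ofLE hle) Function.bijective_id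
  · ext e
    induction e using Sym2.ind with
    | _ a b =>
      have hadj := hp.adj_toSubgraph_iff_of_isCycles h2.isCycles
        (v := a) (w := b) (by rw [SimpleGraph.Walk.mem_verts_toSubgraph]; exact hsupp a)
      simp only [SimpleGraph.Walk.edgeSet, Set.mem_ofPred_eq]
      rw [SimpleGraph.Walk.edges_mapLe_eq_edges, SimpleGraph.mem_edgeSet,
        ← SimpleGraph.Walk.mem_edges_toSubgraph, SimpleGraph.Subgraph.mem_edgeSet]
      exact hadj

end Forest

end OddGraph

namespace OddGraph

open BinaryTree

/-! ### Paths in the middle levels of the cube indexed by binary trees -/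

/-- The binary trees that encode Dyck words. -/
abbrev Tr := BinaryTree Unit

/-- Bitwise complement. -/
def compl (w : List Bool) : List Bool := w.map not

/-- The Dyck word of a binary tree, `true` being an up-step: `u △ v` stands for `1 u 0 v`. -/
def word : Tr → List Bool
  | nil => []
  | node _ u v => true :: (word u ++ false :: word v)

/-- The `s`-th vertex, for `0 ≤ s ≤ 2 n`, of the path from the Dyck word of a tree with `n` nodes to
its complement. For `u △ v` the path goes from `1u0v` to `1u1v`, follows the complement of the
reversed path of `u` to `1ū1v`, proceeds to `0ū1v` and follows the path of `v` to `0ū1v̄`. Its words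
have alternately `n` and `n + 1` ones. -/
def pt : Tr → ℕ → List Bool
  | nil, _ => []
  | node _ u v, s =>
    if s = 0 then true :: (word u ++ false :: word v)
    else if s ≤ 2 * u.numNodes + 1 then
      true :: (compl (pt u (2 * u.numNodes + 1 - s)) ++ true :: word v)
    else false :: (compl (word u) ++ true :: pt v (s - (2 * u.numNodes + 2)))

/-- `Flip x y`: the word `y` arises from `x` by turning one `false` into `true`. -/
def Flip (x y : List Bool) : Prop := ∃ a b, x = a ++ false :: b ∧ y = a ++ true :: b

/-- The end with fewer ones of the `s`-th edge of the path of `t`. -/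
def lo (t : Tr) (s : ℕ) : List Bool := if s % 2 = 0 then pt t s else pt t (s + 1)

/-- The end with more ones of the `s`-th edge of the path of `t`. -/
def up (t : Tr) (s : ℕ) : List Bool := if s % 2 = 0 then pt t (s + 1) else pt t s

section Words

@[simp] lemma compl_nil : compl [] = [] := rfl
@[simp] lemma compl_cons (b : Bool) (w : List Bool) : compl (b :: w) = (!b) :: compl w := rfl
@[simp] lemma compl_append (a b : List Bool) : compl (a ++ b) = compl a ++ compl b := by
  simp [compl]
@[simp] lemma compl_compl (a : List Bool) : compl (compl a) = a := by
  simp [compl, Function.comp_def]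
@[simp] lemma length_compl (a : List Bool) : (compl a).length = a.length := by simp [compl]

lemma count_compl_add (a : List Bool) : (compl a).count true + a.count true = a.length := by
  induction a with
  | nil => rfl
  | cons b a ih => cases b <;> simp <;> omega

lemma numNodes_node (u v : Tr) : (u △ v).numNodes = u.numNodes + v.numNodes + 1 := rfl

@[simp] lemma word_nil : word nil = [] := rfl
@[simp] lemma word_node (u v : Tr) : word (u △ v) = true :: (word u ++ false :: word v) := rfl

@[simp] lemma length_word (t : Tr) : (word t).length = 2 * t.numNodes := by
  induction t using unitRecOn with
  | base => rfl
  | ind u v hu hv => simp [hu, hv]; ring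

@[simp] lemma count_word (t : Tr) : (word t).count true = t.numNodes := by
  induction t using unitRecOn with
  | base => rfl
  | ind u v hu hv => simp [hu, hv]

lemma Flip.cons (c : Bool) {x y : List Bool} (h : Flip x y) : Flip (c :: x) (c :: y) := by
  obtain ⟨a, b, rfl, rfl⟩ := h
  exact ⟨c :: a, b, rfl, rfl⟩

lemma Flip.append_left (c : List Bool) {x y : List Bool} (h : Flip x y) :
    Flip (c ++ x) (c ++ y) := by
  obtain ⟨a, b, rfl, rfl⟩ := h
  exact ⟨c ++ a, b, by simp, by simp⟩

lemma Flip.append_right (c : List Bool) {x y : List Bool} (h : Flip x y) :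
    Flip (x ++ c) (y ++ c) := by
  obtain ⟨a, b, rfl, rfl⟩ := h
  exact ⟨a, b ++ c, by simp, by simp⟩

lemma Flip.compl {x y : List Bool} (h : Flip x y) : Flip (compl y) (compl x) := by
  obtain ⟨a, b, rfl, rfl⟩ := h
  exact ⟨OddGraph.compl a, OddGraph.compl b, by simp, by simp⟩

lemma Flip.head (b : List Bool) : Flip (false :: b) (true :: b) := ⟨[], b, rfl, rfl⟩

end Words

section Path

@[simp] lemma pt_nil (s : ℕ) : pt nil s = [] := rfl

lemma pt_zero (t : Tr) : pt t 0 = word t := by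
  cases t <;> simp [pt, word]

lemma pt_left (u v : Tr) {s : ℕ} (hs : s ≤ 2 * u.numNodes) :
    pt (u △ v) (2 * u.numNodes + 1 - s) = true :: (compl (pt u s) ++ true :: word v) := by
  rw [pt, if_neg (by omega), if_pos (by omega)]
  congr 4
  omega

lemma pt_right (u v : Tr) (s : ℕ) :
    pt (u △ v) (2 * u.numNodes + 2 + s) = false :: (compl (word u) ++ true :: pt v s) := by
  rw [pt, if_neg (by omega), if_neg (by omega)]
  congr 4
  omega

lemma pt_cases (u v : Tr) {s : ℕ} (hs : s ≤ 2 * (u △ v).numNodes) :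
    s = 0 ∨ (∃ s' ≤ 2 * u.numNodes, s = 2 * u.numNodes + 1 - s') ∨
      ∃ s' ≤ 2 * v.numNodes, s = 2 * u.numNodes + 2 + s' := by
  rw [numNodes_node] at hs
  rcases Nat.eq_zero_or_pos s with h | h
  · exact Or.inl h
  · by_cases h' : s ≤ 2 * u.numNodes + 1
    · exact Or.inr (Or.inl ⟨2 * u.numNodes + 1 - s, by omega, by omega⟩)
    · exact Or.inr (Or.inr ⟨s - (2 * u.numNodes + 2), by omega, by omega⟩)

lemma length_pt (t : Tr) : ∀ s ≤ 2 * t.numNodes, (pt t s).length = 2 * t.numNodes := by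
  induction t using unitRecOn with
  | base => simp
  | ind u v hu hv =>
    intro s hs
    rcases pt_cases u v hs with rfl | ⟨s, h, rfl⟩ | ⟨s, h, rfl⟩
    · rw [pt_zero, length_word]
    · rw [pt_left u v h, numNodes_node]; simp [hu s h]; ring
    · rw [pt_right u v s, numNodes_node]; simp [hv s h]; ring

lemma count_pt (t : Tr) : ∀ s ≤ 2 * t.numNodes, (pt t s).count true = t.numNodes + s % 2 := by
  induction t using unitRecOn with
  | base => intro s hs; simp at hs; simp [hs]
  | ind u v hu hv =>
    intro s hs
    rcases pt_cases u v hs with rfl | ⟨s, h, rfl⟩ | ⟨s, h, rfl⟩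
    · rw [pt_zero, count_word]; rfl
    · rw [pt_left u v h, numNodes_node]
      have h1 := count_compl_add (pt u s)
      rw [hu s h, length_pt u s h] at h1
      simp only [List.count_cons, List.count_append, count_word]
      simp
      omega
    · rw [pt_right u v s, numNodes_node]
      have h1 := count_compl_add (word u)
      rw [count_word, length_word] at h1
      simp only [List.count_cons, List.count_append, hv s h]
      simp
      omega

lemma pt_last (t : Tr) : pt t (2 * t.numNodes) = compl (word t) := by
  induction t using unitRecOn with
  | base => rfl
  | ind u v hu hv =>
    have : 2 * (u △ v).numNodes = 2 * u.numNodes + 2 + 2 * v.numNodes := by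
      rw [numNodes_node]; ring
    rw [this, pt_right, hv]
    simp

lemma lo_zero (u v : Tr) : lo (u △ v) 0 = true :: (word u ++ false :: word v) := by
  simp [lo, pt_zero]

lemma up_zero (u v : Tr) : up (u △ v) 0 = true :: (word u ++ true :: word v) := by
  have := pt_left u v (s := 2 * u.numNodes) le_rfl
  rw [show 2 * u.numNodes + 1 - 2 * u.numNodes = 0 + 1 by omega, pt_last] at this
  simpa [up] using this

lemma lo_mid (u v : Tr) :
    lo (u △ v) (2 * u.numNodes + 1) = false :: (compl (word u) ++ true :: word v) := by
  have := pt_right u v 0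
  rw [pt_zero] at this
  rw [lo, if_neg (by omega)]
  exact this

lemma up_mid (u v : Tr) :
    up (u △ v) (2 * u.numNodes + 1) = true :: (compl (word u) ++ true :: word v) := by
  have := pt_left u v (Nat.zero_le _)
  rw [pt_zero] at this
  rw [up, if_neg (by omega)]
  exact this

lemma lo_left (u v : Tr) {s : ℕ} (hs : s < 2 * u.numNodes) :
    lo (u △ v) (2 * u.numNodes - s) = true :: (compl (up u s) ++ true :: word v) := by
  have h1 := pt_left u v hs.le
  have h2 := pt_left u v (s := s + 1) hs
  rw [show 2 * u.numNodes + 1 - s = 2 * u.numNodes - s + 1 by omega] at h1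
  rw [show 2 * u.numNodes + 1 - (s + 1) = 2 * u.numNodes - s by omega] at h2
  rw [lo, up]
  by_cases h : s % 2 = 0
  · rw [if_pos (by omega), if_pos h, h2]
  · rw [if_neg (by omega), if_neg h, h1]

lemma up_left (u v : Tr) {s : ℕ} (hs : s < 2 * u.numNodes) :
    up (u △ v) (2 * u.numNodes - s) = true :: (compl (lo u s) ++ true :: word v) := by
  have h1 := pt_left u v hs.le
  have h2 := pt_left u v (s := s + 1) hs
  rw [show 2 * u.numNodes + 1 - s = 2 * u.numNodes - s + 1 by omega] at h1
  rw [show 2 * u.numNodes + 1 - (s + 1) = 2 * u.numNodes - s by omega] at h2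
  rw [lo, up]
  by_cases h : s % 2 = 0
  · rw [if_pos (by omega), if_pos h, h1]
  · rw [if_neg (by omega), if_neg h, h2]

lemma lo_right (u v : Tr) (s : ℕ) :
    lo (u △ v) (2 * u.numNodes + 2 + s) = false :: (compl (word u) ++ true :: lo v s) := by
  have h1 := pt_right u v s
  have h2 := pt_right u v (s + 1)
  rw [lo, lo]
  by_cases h : s % 2 = 0
  · rw [if_pos (by omega), if_pos h, h1]
  · rw [if_neg (by omega), if_neg h, ← h2, add_assoc]

lemma up_right (u v : Tr) (s : ℕ) :
    up (u △ v) (2 * u.numNodes + 2 + s) = false :: (compl (word u) ++ true :: up v s) := by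
  have h1 := pt_right u v s
  have h2 := pt_right u v (s + 1)
  rw [up, up]
  by_cases h : s % 2 = 0
  · rw [if_pos (by omega), if_pos h, ← h2, add_assoc]
  · rw [if_neg (by omega), if_neg h, h1]

lemma edge_cases (u v : Tr) {s : ℕ} (hs : s < 2 * (u △ v).numNodes) :
    s = 0 ∨ s = 2 * u.numNodes + 1 ∨ (∃ s' < 2 * u.numNodes, s = 2 * u.numNodes - s') ∨
      ∃ s' < 2 * v.numNodes, s = 2 * u.numNodes + 2 + s' := by
  rw [numNodes_node] at hs
  rcases Nat.eq_zero_or_pos s with h | h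
  · exact Or.inl h
  · rcases lt_trichotomy s (2 * u.numNodes + 1) with h' | h' | h'
    · exact Or.inr (Or.inr (Or.inl ⟨2 * u.numNodes - s, by omega, by omega⟩))
    · exact Or.inr (Or.inl h')
    · exact Or.inr (Or.inr (Or.inr ⟨s - (2 * u.numNodes + 2), by omega, by omega⟩))

lemma flip_lo_up (t : Tr) : ∀ s < 2 * t.numNodes, Flip (lo t s) (up t s) := by
  induction t using unitRecOn with
  | base => simp
  | ind u v hu hv =>
    intro s hs
    rcases edge_cases u v hs with rfl | rfl | ⟨s, h, rfl⟩ | ⟨s, h, rfl⟩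
    · rw [lo_zero, up_zero]
      exact ((Flip.head _).append_left _).cons _
    · rw [lo_mid, up_mid]
      exact Flip.head _
    · rw [lo_left u v h, up_left u v h]
      exact ((hu s h).compl.append_right _).cons _
    · rw [lo_right, up_right]
      exact (((hv s h).cons _).append_left _).cons _

end Path

section Cover

lemma exists_word_append : ∀ (n : ℕ) (r : List Bool), r.length = n → 2 * r.count true < r.length →
    ∃ u w, r = word u ++ false :: w := by
  intro n
  induction n using Nat.strong_induction_on with
  | _ n ih =>
    rintro (_ | ⟨_ | _, r⟩) hn h
    · simp at h
    · exact ⟨nil, r, rfl⟩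
    · simp only [List.count_cons, List.length_cons] at h hn
      simp only [beq_self_eq_true, if_true] at h
      obtain ⟨u, w, rfl⟩ := ih r.length (by omega) r rfl (by omega)
      simp only [List.count_append, count_word, List.count_cons, List.length_append, length_word,
        List.length_cons] at h hn
      simp only [beq_iff_eq, Bool.false_eq_true, if_false] at h
      obtain ⟨u', w', rfl⟩ := ih w.length (by omega) w rfl (by omega)
      exact ⟨u △ u', w', by simp⟩

lemma exists_append_word : ∀ (n : ℕ) (r : List Bool), r.length = n →
    (r.length = 2 * r.count true → (∃ t, r = word t) ∨ ∃ p v, r = p ++ true :: word v) ∧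
    (r.length < 2 * r.count true → ∃ p v, r = p ++ true :: word v) := by
  intro n
  induction n using Nat.strong_induction_on with
  | _ n ih =>
    rintro (_ | ⟨_ | _, r⟩) hn
    · exact ⟨fun _ => Or.inl ⟨nil, rfl⟩, fun h => by simp at h⟩
    · simp only [List.length_cons] at hn
      have := ih r.length (by omega) r rfl
      simp only [List.count_cons, List.length_cons]
      simp only [beq_iff_eq, Bool.false_eq_true, if_false]
      have key : r.length + 1 ≤ 2 * (r.count true + 0) → ∃ p v, false :: r = p ++ true :: word v := by
        intro h
        obtain ⟨p, v, hr⟩ := this.2 (by omega)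
        exact ⟨false :: p, v, by rw [hr]; rfl⟩
      exact ⟨fun h => Or.inr (key h.le), fun h => key h.le⟩
    · simp only [List.length_cons] at hn
      have := ih r.length (by omega) r rfl
      simp only [List.count_cons, List.length_cons]
      simp only [beq_self_eq_true, if_true]
      constructor
      · intro h
        obtain ⟨u, w, rfl⟩ := exists_word_append _ r rfl (by omega)
        simp only [List.count_append, count_word, List.count_cons, List.length_append, length_word,
          List.length_cons] at h hn
        simp only [beq_iff_eq, Bool.false_eq_true, if_false] at h
        rcases (ih w.length (by omega) w rfl).1 (by omega) with ⟨v, rfl⟩ | ⟨p, v, rfl⟩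
        · exact Or.inl ⟨u △ v, by simp⟩
        · exact Or.inr ⟨true :: (word u ++ false :: p), v, by simp⟩
      · intro h
        rcases lt_or_ge r.length (2 * r.count true) with h' | h'
        · obtain ⟨p, v, hr⟩ := this.2 h'
          exact ⟨true :: p, v, by rw [hr]; rfl⟩
        · rcases this.1 (by omega) with ⟨v, rfl⟩ | ⟨p, v, hr⟩
          · exact ⟨[], v, rfl⟩
          · exact ⟨true :: p, v, by rw [hr]; rfl⟩

/-- The paths cover the two middle levels of the cube. -/
theorem exists_pt_eq : ∀ (n : ℕ) (w : List Bool), w.length = 2 * n →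
    (w.count true = n ∨ w.count true = n + 1) →
    ∃ t : Tr, t.numNodes = n ∧ ∃ s ≤ 2 * n, pt t s = w := by
  intro n
  induction n using Nat.strong_induction_on with
  | _ n ih =>
    rintro (_ | ⟨_ | _, r⟩) hn h
    · simp only [List.length_nil] at hn
      exact ⟨nil, by simp; omega, 0, by simp, rfl⟩
    · simp only [List.count_cons, List.length_cons] at h hn
      simp only [beq_iff_eq, Bool.false_eq_true, if_false] at h
      obtain ⟨u, w, hr⟩ := exists_word_append _ (compl r) rfl (by
        have := count_compl_add r
        rw [length_compl]; omega)
      have hr : r = compl (word u) ++ true :: compl w := by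
        rw [← compl_compl r, hr]; simp
      have h1 := count_compl_add (word u)
      rw [count_word, length_word] at h1
      rw [hr] at h hn
      simp only [List.count_append, List.count_cons, List.length_append, length_compl, length_word,
        List.length_cons] at h hn
      simp only [beq_self_eq_true, if_true] at h
      obtain ⟨v, hv, s, hs, hw⟩ := ih (n - u.numNodes - 1) (by omega) (compl w)
        (by rw [length_compl]; omega) (by omega)
      refine ⟨u △ v, by rw [numNodes_node]; omega, 2 * u.numNodes + 2 + s, by omega, ?_⟩
      rw [pt_right, hw, hr]
    · have key : ∀ p v, r = p ++ true :: word v →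
          ∃ t : Tr, t.numNodes = n ∧ ∃ s ≤ 2 * n, pt t s = true :: r := by
        rintro p v rfl
        simp only [List.count_append, List.count_cons, List.length_append, count_word, length_word,
          List.length_cons] at h hn
        simp only [beq_self_eq_true, if_true] at h
        have h1 := count_compl_add p
        obtain ⟨u, hu, s, hs, hw⟩ := ih (n - v.numNodes - 1) (by omega) (compl p)
          (by rw [length_compl]; omega) (by omega)
        refine ⟨u △ v, by rw [numNodes_node]; omega, 2 * u.numNodes + 1 - s, by omega, ?_⟩
        rw [pt_left u v (by omega), hw, compl_compl]
      simp only [List.count_cons, List.length_cons] at h hn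
      simp only [beq_self_eq_true, if_true] at h
      rcases h with h | h
      · obtain ⟨u, w, hr⟩ := exists_word_append _ r rfl (by omega)
        subst hr
        simp only [List.count_append, count_word, List.count_cons, List.length_append, length_word,
          List.length_cons] at h hn
        simp only [beq_iff_eq, Bool.false_eq_true, if_false] at h
        rcases (exists_append_word _ w rfl).1 (by omega) with ⟨v, rfl⟩ | ⟨p, v, rfl⟩
        · rw [length_word] at hn
          exact ⟨u △ v, by rw [numNodes_node]; omega, 0, by omega, by rw [pt_zero, word_node]⟩
        · exact key (word u ++ false :: p) v (by simp)
      · obtain ⟨p, v, hr⟩ := (exists_append_word _ r rfl).2 (by omega)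
        exact key p v hr

end Cover

end OddGraph

namespace OddGraph

open BinaryTree Finset

/-! ### The standard 2-factor of the odd graph -/

section OnesOfWord

/-- The set of positions of the ones of a word. -/
def ones (k : ℕ) (w : List Bool) : Finset (Fin (2 * k + 1)) :=
  univ.filter fun i => w[i.val]? = some true

lemma mem_ones {k : ℕ} {w : List Bool} {i : Fin (2 * k + 1)} :
    i ∈ ones k w ↔ w[i.val]? = some true := by simp [ones]

lemma card_filter_getElem? : ∀ (w : List Bool) (N : ℕ), w.length ≤ N →
    #(univ.filter fun i : Fin N => w[i.val]? = some true) = w.count true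
  | [], N, _ => by simp
  | b :: w, 0, h => by simp at h
  | b :: w, N + 1, h => by
    rw [Fin.card_filter_univ_succ]
    have := card_filter_getElem? w N (by simpa using h)
    cases b <;> simp [this]

lemma card_ones {k : ℕ} {w : List Bool} (h : w.length ≤ 2 * k + 1) :
    #(ones k w) = w.count true := card_filter_getElem? w _ h

lemma Flip.ones_subset {x y : List Bool} (h : Flip x y) (k : ℕ) : ones k x ⊆ ones k y := by
  obtain ⟨a, b, rfl, rfl⟩ := h
  intro i
  simp only [mem_ones]
  intro hi
  rcases lt_trichotomy i.val a.length with h | h | h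
  · rw [List.getElem?_append_left h] at hi ⊢; exact hi
  · rw [h, List.getElem?_append_right le_rfl]; simp
  · rw [List.getElem?_append_right h.le] at hi ⊢
    obtain ⟨j, hj⟩ : ∃ j, i.val - a.length = j + 1 := ⟨i.val - a.length - 1, by omega⟩
    rw [hj] at hi ⊢
    exact hi

lemma disjoint_ones_compl (w : List Bool) (k : ℕ) : Disjoint (ones k w) (ones k (compl w)) := by
  rw [Finset.disjoint_left]
  intro i hi hi'
  rw [mem_ones] at hi hi'
  simp [compl, hi] at hi'

/-- The word `w` is assigned to the set of its ones or of its zeros, the latter in the ground set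
with one more element than the length of `w`. -/
def vertexSet (k : ℕ) (w : List Bool) (s : ℕ) : Finset (Fin (2 * k + 1)) :=
  if s % 2 = 0 then ones k w else (ones k w)ᶜ

lemma card_vertexSet {t : Tr} {s : ℕ} (hs : s ≤ 2 * t.numNodes) :
    #(vertexSet t.numNodes (pt t s) s) = t.numNodes := by
  have h1 := card_ones (k := t.numNodes) (w := pt t s) (by rw [length_pt t s hs]; omega)
  rw [count_pt t s hs] at h1
  rw [vertexSet]
  split_ifs with h
  · omega
  · rw [card_compl, h1, Fintype.card_fin]; omega

lemma exists_vertexSet_eq {k : ℕ} (S : Finset (Fin (2 * k + 1))) (hS : #S = k) :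
    ∃ t : Tr, t.numNodes = k ∧ ∃ s ≤ 2 * k, vertexSet k (pt t s) s = S := by
  by_cases hl : Fin.last (2 * k) ∈ S
  · set w := List.ofFn fun i : Fin (2 * k) => decide (Fin.castSucc i ∉ S) with hw
    have hw' : ones k w = Sᶜ := by
      ext i
      rw [mem_ones, mem_compl]
      refine Fin.lastCases ?_ (fun i => ?_) i
      · simp [hw, hl]
      · simp [hw]
    have hwl : w.length = 2 * k := by simp [hw]
    have hc := card_ones (k := k) (w := w) (by omega)
    rw [hw', card_compl, hS, Fintype.card_fin] at hc
    obtain ⟨t, ht, s, hs, hp⟩ := exists_pt_eq k w hwl (Or.inr (by omega))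
    refine ⟨t, ht, s, hs, ?_⟩
    have := count_pt t s (by omega)
    rw [vertexSet, if_neg (by rw [hp] at this; omega), hp, hw', _root_.compl_compl]
  · set w := List.ofFn fun i : Fin (2 * k) => decide (Fin.castSucc i ∈ S) with hw
    have hw' : ones k w = S := by
      ext i
      rw [mem_ones]
      refine Fin.lastCases ?_ (fun i => ?_) i
      · simp [hw, hl]
      · simp [hw]
    have hwl : w.length = 2 * k := by simp [hw]
    have hc := card_ones (k := k) (w := w) (by omega)
    rw [hw', hS] at hc
    obtain ⟨t, ht, s, hs, hp⟩ := exists_pt_eq k w hwl (Or.inl (by omega))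
    refine ⟨t, ht, s, hs, ?_⟩
    have := count_pt t s (by omega)
    rw [vertexSet, if_pos (by rw [hp] at this; omega), hp, hw']

end OnesOfWord

section Factor

/-- The `s`-th vertices of the paths of all trees with `k` nodes, for `0 ≤ s ≤ 2 k`. -/
abbrev Pos (k : ℕ) := ↥(treesOfNumNodesEq k) × Fin (2 * k + 1)

lemma numNodes_eq {k : ℕ} (t : ↥(treesOfNumNodesEq k)) : t.1.numNodes = k :=
  mem_treesOfNumNodesEq.1 t.2

/-- The vertex of the odd graph at a given place of a path. -/
def vertex (k : ℕ) (x : Pos k) : {s : Finset (Fin (2 * k + 1)) // #s = k} :=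
  ⟨vertexSet k (pt x.1.1 x.2) x.2, by
    have h := numNodes_eq x.1
    have := card_vertexSet (t := x.1.1) (s := x.2.val) (by have := x.2.isLt; omega)
    rwa [h] at this⟩

lemma vertex_bijective (k : ℕ) : Function.Bijective (vertex k) := by
  rw [Fintype.bijective_iff_surjective_and_card]
  constructor
  · rintro ⟨S, hS⟩
    obtain ⟨t, ht, s, hs, h⟩ := exists_vertexSet_eq S hS
    exact ⟨(⟨t, mem_treesOfNumNodesEq.2 ht⟩, ⟨s, by omega⟩), Subtype.ext h⟩
  · rw [Fintype.card_prod, Fintype.card_coe, treesOfNumNodesEq_card_eq_catalan, Fintype.card_fin,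
      Fintype.card_finset_len, Fintype.card_fin]
    have h1 := succ_mul_catalan_eq_centralBinom k
    have h2 := Nat.add_one_mul_choose_eq (2 * k) k
    rw [← Nat.centralBinom_eq_two_mul_choose, ← h1] at h2
    have h3 := Nat.choose_symm_of_eq_add (n := 2 * k + 1) (a := k + 1) (b := k) (by ring)
    rw [h3] at h2
    refine Nat.eq_of_mul_eq_mul_right k.succ_pos ?_
    rw [Nat.succ_eq_add_one, ← h2]
    ring

/-- The places of the paths as vertices of the odd graph. -/
noncomputable def vertexEquiv (k : ℕ) : Pos k ≃ {s : Finset (Fin (2 * k + 1)) // #s = k} :=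
  Equiv.ofBijective _ (vertex_bijective k)

/-- The paths of all trees, each closed to a cycle by an edge between its two ends. -/
def factor (k : ℕ) : SimpleGraph (Pos k) where
  Adj x y := x.1 = y.1 ∧ (SimpleGraph.cycleGraph (2 * k + 1)).Adj x.2 y.2
  symm := ⟨fun _ _ h => ⟨h.1.symm, h.2.symm⟩⟩
  loopless := ⟨fun _ h => h.2.ne rfl⟩

lemma cycleGraph_ncard {N : ℕ} (hN : 3 ≤ N) (v : Fin N) :
    ((SimpleGraph.cycleGraph N).neighborSet v).ncard = 2 := by
  obtain ⟨m, rfl⟩ := Nat.exists_eq_add_of_le' hN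
  rw [← SimpleGraph.cycleGraph_degree_three_le (v := v), SimpleGraph.degree,
    SimpleGraph.neighborFinset, Set.ncard_eq_toFinset_card']

lemma cycleGraph_adj_iff {N : ℕ} (hN : 3 ≤ N) (a b : Fin N) :
    (SimpleGraph.cycleGraph N).Adj a b ↔ a.val + 1 = b.val ∨ b.val + 1 = a.val ∨
      (a.val = 0 ∧ b.val + 1 = N) ∨ (b.val = 0 ∧ a.val + 1 = N) := by
  have ha := a.isLt
  have hb := b.isLt
  have key : ∀ x y : ℕ, x < N → y < N →
      ((N - y + x) % N = 1 ↔ y + 1 = x ∨ (x = 0 ∧ y + 1 = N)) := by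
    intro x y hx hy
    rcases lt_or_ge x y with h | h
    · rw [Nat.mod_eq_of_lt (by omega)]; omega
    · rw [show N - y + x = x - y + N by omega, Nat.add_mod_right, Nat.mod_eq_of_lt (by omega)]
      omega
  rw [SimpleGraph.cycleGraph_adj', Fin.sub_def, Fin.sub_def]
  simp only [key _ _ ha hb, key _ _ hb ha]
  omega

lemma factor_twoRegular {k : ℕ} (hk : 1 ≤ k) : TwoRegular (factor k) := by
  intro v
  have : (factor k).neighborSet v =
      Prod.mk v.1 '' (SimpleGraph.cycleGraph (2 * k + 1)).neighborSet v.2 := by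
    ext ⟨t, s⟩
    simp [factor, and_comm]
  rw [this, Set.ncard_image_of_injective _ (Prod.mk_right_injective _),
    cycleGraph_ncard (by omega)]

lemma factor_reachable {k : ℕ} (a b : Pos k) (h : a.1 = b.1) : (factor k).Reachable a b := by
  obtain ⟨t, s⟩ := a
  obtain ⟨t', s'⟩ := b
  obtain rfl : t = t' := h
  refine reachable_of_forall_adj (Prod.mk t) (fun x y hxy => SimpleGraph.Adj.reachable ?_)
    (SimpleGraph.cycleGraph_connected.preconnected s s')
  exact ⟨rfl, hxy⟩

lemma oddGraph_adj_of_disjoint {k : ℕ} (hk : 1 ≤ k)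
    {s t : {s : Finset (Fin (2 * k + 1)) // #s = k}} (h : Disjoint s.1 t.1) :
    (oddGraph k).Adj s t := by
  refine ⟨?_, h⟩
  rintro rfl
  have h1 := s.2
  rw [disjoint_self.1 h] at h1
  simp at h1
  omega

lemma vertex_adj_of_flip {k : ℕ} (hk : 1 ≤ k) {x y : Pos k} (hx : x.2.val % 2 = 0)
    (hy : y.2.val % 2 = 1) (h : Flip (pt x.1.1 x.2) (pt y.1.1 y.2)) :
    (oddGraph k).Adj (vertex k x) (vertex k y) := by
  refine oddGraph_adj_of_disjoint hk ?_
  simp only [vertex, vertexSet]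
  rw [if_pos hx, if_neg (by omega)]
  exact disjoint_compl_right.mono_left (h.ones_subset k)

lemma factor_adj_vertex {k : ℕ} (hk : 1 ≤ k) {x y : Pos k} (h : (factor k).Adj x y) :
    (oddGraph k).Adj (vertex k x) (vertex k y) := by
  have key : ∀ x y : Pos k, x.1 = y.1 → x.2.val + 1 = y.2.val →
      (oddGraph k).Adj (vertex k x) (vertex k y) := by
    rintro ⟨t, s⟩ ⟨t', s'⟩ h h'
    obtain rfl : t = t' := h
    simp only at h'
    have ht := numNodes_eq t
    have hf := flip_lo_up t.1 s.val (by have := s'.isLt; omega)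
    rw [lo, up] at hf
    by_cases hs : s.val % 2 = 0
    · rw [if_pos hs, if_pos hs, h'] at hf
      exact vertex_adj_of_flip hk hs (by simp only; omega) hf
    · rw [if_neg hs, if_neg hs, h'] at hf
      exact (vertex_adj_of_flip hk (by simp only; omega) (by simp only; omega) hf).symm
  have key2 : ∀ x y : Pos k, x.1 = y.1 → x.2.val = 0 → y.2.val + 1 = 2 * k + 1 →
      (oddGraph k).Adj (vertex k x) (vertex k y) := by
    rintro ⟨t, s⟩ ⟨t', s'⟩ h h0 h'
    obtain rfl : t = t' := h
    simp only at h' h0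
    refine oddGraph_adj_of_disjoint hk ?_
    have hl : s'.val = 2 * t.1.numNodes := by rw [numNodes_eq]; omega
    simp only [vertex, vertexSet, h0, hl, pt_zero, pt_last]
    simpa using disjoint_ones_compl _ _
  obtain ⟨h1, h2⟩ := h
  rw [cycleGraph_adj_iff (by omega)] at h2
  rcases h2 with h2 | h2 | ⟨h2, h3⟩ | ⟨h2, h3⟩
  · exact key _ _ h1 h2
  · exact (key _ _ h1.symm h2).symm
  · exact key2 _ _ h1 h2 h3
  · exact (key2 _ _ h1.symm h2 h3).symm

end Factor

section Scheme

/-- A set of polygons in the odd graph `O_n` along which the cycles of the standard 2-factor can be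
merged. A pair `(t, s)` stands for the `s`-th edge of the path of the tree `t`. A polygon is the
list of its edges in the 2-factor, in cyclic order; its other edges join the upper end of a member
of the list to the lower end of the next one. -/
structure IsScheme (n : ℕ) (P : Set (List (Tr × ℕ))) : Prop where
  order : ∀ h ∈ P, ∀ e ∈ h, e.1.numNodes = n ∧ e.2 < 2 * n
  two_le : ∀ h ∈ P, 2 ≤ h.length
  cyclic : ∀ h ∈ P, Cyclic (fun e e' => Flip (lo e'.1 e'.2) (up e.1 e.2)) h
  disjoint : ∀ h ∈ P, ∀ h' ∈ P, ∀ e ∈ h, e ∈ h' → h = h'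
  forest : Forest Prod.fst P

/-- The polygons of `P` connect all trees with `n` nodes. -/
def Connects (n : ℕ) (P : Set (List (Tr × ℕ))) : Prop :=
  ∀ f : Tr → Prop, ConstOn (fun e => f e.1) P →
    ∀ t t' : Tr, t.numNodes = n → t'.numNodes = n → f t = f t'

/-- The path edges that are used by the polygons of `P`. -/
def used (P : Set (List (Tr × ℕ))) : Set (Tr × ℕ) := {e | ∃ h ∈ P, e ∈ h}

instance (k : ℕ) : Nonempty ↥(treesOfNumNodesEq k) := by
  rw [← Fintype.card_pos_iff, Fintype.card_coe, treesOfNumNodesEq_card_eq_catalan]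
  have := succ_mul_catalan_eq_centralBinom k
  have := Nat.centralBinom_pos k
  exact Nat.pos_of_ne_zero fun h => by simp_all

open Classical in
/-- A tree with `k` nodes; trees with another number of nodes have the junk value of an arbitrary
one. -/
noncomputable def treeOf (k : ℕ) (t : Tr) : ↥(treesOfNumNodesEq k) :=
  if h : t ∈ treesOfNumNodesEq k then ⟨t, h⟩ else Classical.arbitrary _

lemma treeOf_val {k : ℕ} {t : Tr} (h : t.numNodes = k) : (treeOf k t).1 = t := by
  rw [treeOf, dif_pos (mem_treesOfNumNodesEq.2 h)]

/-- The lower and the upper end of a path edge. -/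
noncomputable def ends (k : ℕ) (e : Tr × ℕ) : Pos k × Pos k :=
  ((treeOf k e.1, Fin.ofNat _ (e.2 + e.2 % 2)), (treeOf k e.1, Fin.ofNat _ (e.2 + 1 - e.2 % 2)))

/-- A path edge as an edge of the odd graph. -/
noncomputable def pathEdge (k : ℕ) (e : Tr × ℕ) :
    Sym2 {s : Finset (Fin (2 * k + 1)) // #s = k} :=
  s(vertex k (ends k e).1, vertex k (ends k e).2)

lemma val_ends {k : ℕ} {e : Tr × ℕ} (h : e.2 < 2 * k) :
    (ends k e).1.2.val = e.2 + e.2 % 2 ∧ (ends k e).2.2.val = e.2 + 1 - e.2 % 2 := by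
  constructor
  · simp only [ends, Fin.ofNat]; exact Nat.mod_eq_of_lt (by omega)
  · simp only [ends, Fin.ofNat]; exact Nat.mod_eq_of_lt (by omega)

lemma pt_ends {k : ℕ} {e : Tr × ℕ} (h1 : e.1.numNodes = k) (h2 : e.2 < 2 * k) :
    pt (ends k e).1.1.1 (ends k e).1.2 = lo e.1 e.2 ∧
    pt (ends k e).2.1.1 (ends k e).2.2 = up e.1 e.2 := by
  rw [(val_ends h2).1, (val_ends h2).2, lo, up]
  simp only [ends, treeOf_val h1]
  by_cases h : e.2 % 2 = 0
  · simp [h]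
  · simp [show e.2 % 2 = 1 by omega]

lemma factor_adj_ends {k : ℕ} (hk : 1 ≤ k) {e : Tr × ℕ} (h2 : e.2 < 2 * k) :
    (factor k).Adj (ends k e).1 (ends k e).2 := by
  refine ⟨rfl, ?_⟩
  rw [cycleGraph_adj_iff (by omega), (val_ends h2).1, (val_ends h2).2]
  omega

lemma ends_injective {k : ℕ} {e e' : Tr × ℕ} (h1 : e.1.numNodes = k) (h2 : e.2 < 2 * k)
    (h1' : e'.1.numNodes = k) (h2' : e'.2 < 2 * k)
    (h : s((ends k e).1, (ends k e).2) = s((ends k e').1, (ends k e').2)) : e = e' := by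
  have a1 := val_ends h2
  have a2 := val_ends h2'
  rcases Sym2.eq_iff.1 h with ⟨g1, g2⟩ | ⟨g1, g2⟩
  · refine Prod.ext ?_ ?_
    · have := congrArg (fun x => x.1.1) g1
      simpa only [ends, treeOf_val h1, treeOf_val h1'] using this
    · rw [g1, g2] at a1
      omega
  · rw [g1, g2] at a1
    omega

/-- A connecting scheme yields a Hamilton cycle, from which the used path edges can be recovered. -/
theorem IsScheme.exists_hamiltonCycle {k : ℕ} (hk : 1 ≤ k) {P : Set (List (Tr × ℕ))}
    (hP : IsScheme k P) (hc : Connects k P) :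
    ∃ C ∈ (oddGraph k).hamiltonCycles, ∀ e : Tr × ℕ, e.1.numNodes = k → e.2 < 2 * k →
      (pathEdge k e ∈ C ↔ e ∉ used P) := by
  have h2 := factor_twoRegular hk
  have hcol : ∀ a b, (factor k).Adj a b → a.1.1 = b.1.1 := fun a b h => by rw [h.1]
  have hadj : ∀ h ∈ P, ∀ e ∈ h, (factor k).Adj (ends k e).1 (ends k e).2 := fun h hh e he =>
    factor_adj_ends hk (hP.order h hh e he).2
  have hlab : ∀ h ∈ P, ∀ e ∈ h, (ends k e).1.1.1 = e.1 := fun h hh e he =>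
    treeOf_val (hP.order h hh e he).1
  have hdis : ∀ h ∈ P, ∀ h' ∈ P, ∀ e ∈ h, ∀ e' ∈ h',
      s((ends k e).1, (ends k e).2) = s((ends k e').1, (ends k e').2) → h = h' := by
    intro h hh h' hh' e he e' he' hx
    have o1 := hP.order h hh e he
    have o2 := hP.order h' hh' e' he'
    obtain rfl := ends_injective o1.1 o1.2 o2.1 o2.2 hx
    exact hP.disjoint h hh h' hh' e he he'
  obtain ⟨i1, -, -, i4, -⟩ := switched_of_forest h2 (c := fun x : Pos k => x.1.1) hcol hP.forest
    hadj hlab hP.two_le hdis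
  have i6 := connected_of_forest h2 (c := fun x : Pos k => x.1.1) hcol
    (fun a b h => factor_reachable a b (Subtype.ext h)) hP.forest hadj hlab hP.two_le hdis
    (fun f hf a b => hc f hf _ _ (numNodes_eq _) (numNodes_eq _))
  set S := switched (factor k) (ends k) P with hS
  let φ : S.comap (vertexEquiv k).symm ≃g S := ⟨(vertexEquiv k).symm, Iff.rfl⟩
  have hsymm : ∀ x, (vertexEquiv k).symm (vertex k x) = x := (vertexEquiv k).symm_apply_apply
  have : Nonempty {s : Finset (Fin (2 * k + 1)) // #s = k} :=
    (vertexEquiv k).symm.nonempty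
  refine ⟨(S.comap (vertexEquiv k).symm).edgeSet,
    exists_isHamiltonianCycle ?_ ?_ (φ.connected_iff.2 i6), ?_⟩
  · intro a b hab
    obtain ⟨a, rfl⟩ := (vertexEquiv k).surjective a
    obtain ⟨b, rfl⟩ := (vertexEquiv k).surjective b
    change (oddGraph k).Adj (vertex k a) (vertex k b)
    simp only [SimpleGraph.comap_adj, Equiv.symm_apply_apply] at hab
    rw [hS, switched, exchange_adj] at hab
    rcases hab with ⟨hab, -⟩ | ⟨⟨h, hh, hab⟩, -⟩
    · exact factor_adj_vertex hk hab
    · obtain ⟨e, he, e', he', hf, hx⟩ := (hP.cyclic h hh).of_mem hab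
      have o1 := hP.order h hh e he
      have o2 := hP.order h hh e' he'
      have v1 := (val_ends o1.2).2
      have v2 := (val_ends o2.2).1
      have : (oddGraph k).Adj (vertex k (ends k e').1) (vertex k (ends k e).2) := by
        refine vertex_adj_of_flip hk (by omega) (by omega) ?_
        rw [(pt_ends o1.1 o1.2).2, (pt_ends o2.1 o2.2).1]
        exact hf
      rcases Sym2.eq_iff.1 hx with ⟨rfl, rfl⟩ | ⟨rfl, rfl⟩
      exacts [this.symm, this]
  · intro v
    refine Eq.trans ?_ (i1 ((vertexEquiv k).symm v))
    exact Set.ncard_preimage_of_injective_subset_range (s := S.neighborSet _)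
      (vertexEquiv k).symm.injective (by simp)
  · intro e he1 he2
    rw [pathEdge, SimpleGraph.mem_edgeSet, SimpleGraph.comap_adj, hsymm, hsymm, hS, switched,
      exchange_adj]
    constructor
    · rintro (⟨-, h⟩ | ⟨⟨h, hh, hx⟩, -⟩)
      · rintro ⟨h', hh', he'⟩
        exact h ⟨h', hh', mem_removedEdges_map.2 ⟨e, he', rfl⟩⟩
      · exact (i4 h hh _ _ hx rfl).elim
    · refine fun h => Or.inl ⟨factor_adj_ends hk he2, ?_⟩
      rintro ⟨h', hh', hx⟩
      obtain ⟨e', he', hx⟩ := mem_removedEdges_map.1 hx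
      have o := hP.order h' hh' e' he'
      obtain rfl := ends_injective he1 he2 o.1 o.2 hx
      exact h ⟨h', hh', he'⟩

end Scheme

end OddGraph

namespace OddGraph

open BinaryTree

/-! ### Lifting schemes to the two subtrees -/

section ForestLemmas

variable {α β X Y : Type*}

lemma chainRel_iff {R : α → α → Prop} {l : List α} {d d₀ : α} :
    ChainRel R d l d₀ ↔ List.IsChain R (d :: (l ++ [d₀])) := by
  induction l generalizing d with
  | nil => simp [ChainRel]
  | cons a l ih => simp [ChainRel, ih]

lemma ChainRel.map {R : α → α → Prop} {S : β → β → Prop} {f : α → β}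
    (H : ∀ a b, R a b → S (f a) (f b)) {l : List α} {d d₀ : α} (h : ChainRel R d l d₀) :
    ChainRel S (f d) (l.map f) (f d₀) := by
  induction l generalizing d with
  | nil => exact H _ _ h
  | cons a l ih => exact ⟨H _ _ h.1, ih h.2⟩

/-- The same polygon, traversed in the opposite direction from its first edge on. -/
def turn : List α → List α
  | [] => []
  | d :: l => d :: l.reverse

lemma turn_perm (l : List α) : (turn l).Perm l := by
  cases l with
  | nil => exact .refl _
  | cons d l => exact (List.reverse_perm l).cons d

lemma Cyclic.map {R : α → α → Prop} {S : β → β → Prop} {f : α → β}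
    (H : ∀ a b, R a b → S (f a) (f b)) {l : List α} (h : Cyclic R l) : Cyclic S (l.map f) := by
  cases l with
  | nil => trivial
  | cons d l => exact ChainRel.map H h

lemma Cyclic.turn {R : α → α → Prop} {l : List α} (h : Cyclic R l) :
    Cyclic (fun a b => R b a) (turn l) := by
  cases l with
  | nil => trivial
  | cons d l =>
    have h : ChainRel R d l d := h
    change ChainRel _ d l.reverse d
    rw [chainRel_iff] at h ⊢
    have := List.isChain_reverse.2 h
    simpa [flip] using this

lemma Cyclic.and {R S : α → α → Prop} {l : List α} (h : Cyclic R l) (hS : ∀ a ∈ l, ∀ b ∈ l, S a b) :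
    Cyclic (fun a b => R a b ∧ S a b) l := by
  cases l with
  | nil => trivial
  | cons d l =>
    have key : ∀ (l' : List α) (d' : α), d' ∈ d :: l → (∀ x ∈ l', x ∈ d :: l) →
        ChainRel R d' l' d → ChainRel (fun a b => R a b ∧ S a b) d' l' d := by
      intro l'
      induction l' with
      | nil => exact fun d' hd _ h => ⟨h, hS _ hd _ (by simp)⟩
      | cons a l' ih =>
        intro d' hd hl h
        exact ⟨⟨h.1, hS _ hd _ (hl a (by simp))⟩,
          ih a (hl a (by simp)) (fun x hx => hl x (List.mem_cons_of_mem _ hx)) h.2⟩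
    exact key l d (by simp) (fun x hx => List.mem_cons_of_mem _ hx) h

/-- A forest can be enlarged by a copy of another one, if all functions telling apart the components
of the latter extend to functions that are constant on the polygons of the former. -/
lemma Forest.union_image {lab : α → X} {lab' : β → Y} {P : Set (List α)} {Q : Set (List β)}
    (g : List β → List α) (φ : β → α) (hg : ∀ h, (g h).Perm (h.map φ)) (hP : Forest lab P)
    (hQ : Forest lab' Q) (H : ∀ r' : Y → Y, ∃ r : X → X, ConstOn (fun e => r (lab e)) P ∧
      ∃ i : Y → X, Function.Injective i ∧ ∀ h ∈ Q, ∀ e ∈ h, r (lab (φ e)) = i (r' (lab' e))) :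
    Forest lab (P ∪ g '' Q) := by
  induction hQ with
  | empty => simpa using hP
  | @insert Q h r' hQ hr hh ih =>
    rw [Set.image_insert_eq, Set.union_insert]
    obtain ⟨r, h1, i, h2, h3⟩ := H r'
    refine Forest.insert r (ih ?_) ?_ ?_
    · intro r'
      obtain ⟨r, h1, i, h2, h3⟩ := H r'
      exact ⟨r, h1, i, h2, fun h hh => h3 h (Or.inr hh)⟩
    · rintro k (hk | ⟨k, hk, rfl⟩) e he e' he'
      · exact h1 k hk e he e' he'
      · rw [(hg k).mem_iff] at he he'
        obtain ⟨d, hd, rfl⟩ := List.mem_map.1 he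
        obtain ⟨d', hd', rfl⟩ := List.mem_map.1 he'
        simp only
        rw [h3 k (Or.inr hk) d hd, h3 k (Or.inr hk) d' hd']
        exact congrArg i (hr k hk d hd d' hd')
    · have : (h.map fun e => i (r' (lab' e))).Nodup := by
        have := hh.map h2
        rwa [List.map_map] at this
      refine (((hg h).map _).nodup_iff).2 ?_
      rw [List.map_map]
      convert this using 1
      exact List.map_congr_left fun e he => h3 h (Or.inl rfl) e he

end ForestLemmas

section Lifts

/-- The tree whose Dyck word is `1…10…0`. -/
def main : ℕ → Tr
  | 0 => nil
  | n + 1 => main n △ nil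

/-- The tree whose Dyck word is `1010…10`. -/
def comb : ℕ → Tr
  | 0 => nil
  | n + 1 => nil △ comb n

@[simp] lemma numNodes_main (n : ℕ) : (main n).numNodes = n := by
  induction n with
  | zero => rfl
  | succ n ih => rw [main, numNodes_node, ih]; simp

@[simp] lemma numNodes_comb (n : ℕ) : (comb n).numNodes = n := by
  induction n with
  | zero => rfl
  | succ n ih => rw [comb, numNodes_node, ih]; simp

/-- A representative of the component of `v` with respect to a scheme for the trees with as many
nodes as `v`. There is no connecting scheme for the trees with two nodes, hence these are kept
apart. -/
def rep (v : Tr) : Tr := if v.numNodes = 2 then v else main v.numNodes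

/-- A representative of the component of a tree with respect to the lifted schemes. -/
def pairRep : Tr → Tr
  | nil => nil
  | node _ u v => rep u △ rep v

@[simp] lemma pairRep_node (u v : Tr) : pairRep (u △ v) = rep u △ rep v := rfl

@[simp] lemma numNodes_rep (v : Tr) : (rep v).numNodes = v.numNodes := by
  rw [rep]; split_ifs <;> simp

@[simp] lemma rep_rep (v : Tr) : rep (rep v) = rep v := by
  conv_lhs => rw [rep, numNodes_rep]
  split_ifs with h
  · rfl
  · rw [rep, if_neg h]

lemma rep_of_ne {v : Tr} (h : v.numNodes ≠ 2) : rep v = main v.numNodes := if_neg h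

lemma rep_of_eq {v : Tr} (h : v.numNodes = 2) : rep v = v := if_pos h

/-- The edge of the path of `u △ v` that lies over an edge of the path of `v`. -/
def liftRight (u : Tr) (e : Tr × ℕ) : Tr × ℕ := (u △ e.1, 2 * u.numNodes + 2 + e.2)

/-- The edge of the path of `u △ v` that lies over an edge of the path of `u`, which is traversed
backwards. -/
def liftLeft (v : Tr) (e : Tr × ℕ) : Tr × ℕ := (e.1 △ v, 2 * e.1.numNodes - e.2)

/-- The polygons over those in `PV u` for the right and in `PU v` for the left subtree. One left
lift for each class of right subtrees suffices, since the classes are already connected. -/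
def lifts (n : ℕ) (PV PU : Tr → Set (List (Tr × ℕ))) : Set (List (Tr × ℕ)) :=
  {h | ∃ u : Tr, u.numNodes < n ∧ ∃ k ∈ PV u, h = k.map (liftRight u)} ∪
  {h | ∃ v : Tr, v.numNodes < n ∧ rep v = v ∧ ∃ k ∈ PU v, h = turn (k.map (liftLeft v))}

lemma forest_liftRight {PV : Tr → Set (List (Tr × ℕ))} (T : Finset Tr)
    (hT : ∀ u ∈ T, Forest Prod.fst (PV u)) :
    Forest Prod.fst {h | ∃ u ∈ T, ∃ k ∈ PV u, h = k.map (liftRight u)} := by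
  induction T using Finset.induction_on with
  | empty =>
    convert Forest.empty
    simp
  | @insert u T hu ih =>
    have := Forest.union_image (fun k => k.map (liftRight u)) (liftRight u) (fun h => .refl _)
      (ih fun u hu => hT u (Finset.mem_insert_of_mem hu)) (hT u (Finset.mem_insert_self _ _)) ?_
    · convert this using 1
      ext h
      simp only [Finset.mem_insert, exists_eq_or_imp, Set.mem_ofPred_eq, Set.mem_union,
        Set.mem_image, eq_comm (b := h)]
      exact or_comm
    · intro r
      refine ⟨fun x => match x with
        | nil => nil
        | node _ a b => if a = u then r b △ nil else nil, ?_, fun y => y △ nil, ?_, ?_⟩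
      · rintro h ⟨u', hu', k, hk, rfl⟩ e he e' he'
        obtain ⟨e, he, rfl⟩ := List.mem_map.1 he
        obtain ⟨e', he', rfl⟩ := List.mem_map.1 he'
        have : u' ≠ u := fun h => hu (h ▸ hu')
        simp [liftRight, this]
      · intro a b h
        simpa using h
      · intro h _ e _
        simp [liftRight]

lemma forest_liftLeft {P : Set (List (Tr × ℕ))} {PU : Tr → Set (List (Tr × ℕ))}
    (hP : Forest Prod.fst P)
    (hrep : ∀ h ∈ P, ∀ e ∈ h, ∀ e' ∈ h, ∃ u v v' : Tr, e.1 = u △ v ∧ e'.1 = u △ v' ∧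
      rep v = rep v')
    (T : Finset Tr) (hT : ∀ v ∈ T, Forest Prod.fst (PU v)) (hT' : ∀ v ∈ T, rep v = v) :
    Forest Prod.fst (P ∪ {h | ∃ v ∈ T, ∃ k ∈ PU v, h = turn (k.map (liftLeft v))}) := by
  induction T using Finset.induction_on with
  | empty => simpa using hP
  | @insert v T hv ih =>
    have := Forest.union_image (fun k => turn (k.map (liftLeft v))) (liftLeft v)
      (fun h => turn_perm _)
      (ih (fun v hv => hT v (Finset.mem_insert_of_mem hv))
        (fun v hv => hT' v (Finset.mem_insert_of_mem hv))) (hT v (Finset.mem_insert_self _ _)) ?_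
    · convert this using 1
      ext h
      simp only [Finset.mem_insert, exists_eq_or_imp, Set.mem_ofPred_eq, Set.mem_union,
        Set.mem_image, eq_comm (b := h)]
      exact (or_congr_right or_comm).trans or_assoc.symm
    · intro r
      refine ⟨fun x => match x with
        | nil => nil
        | node _ a b => if rep b = v then r a △ nil else nil, ?_, fun y => y △ nil, ?_, ?_⟩
      · rintro h (hh | ⟨v', hv', k, hk, rfl⟩) e he e' he'
        · obtain ⟨a, b, b', h1, h2, h3⟩ := hrep h hh e he e' he'
          simp only [h1, h2, h3]
        · rw [(turn_perm _).mem_iff] at he he'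
          obtain ⟨e, he, rfl⟩ := List.mem_map.1 he
          obtain ⟨e', he', rfl⟩ := List.mem_map.1 he'
          have h1 : v' ≠ v := fun h => hv (h ▸ hv')
          have h2 := hT' v' (Finset.mem_insert_of_mem hv')
          simp [liftLeft, h1, h2]
      · intro a b h
        simpa using h
      · intro h _ e _
        simp [liftLeft, hT' v (Finset.mem_insert_self _ _)]

variable {n : ℕ} {PV PU : Tr → Set (List (Tr × ℕ))}

lemma mem_used_lifts {e : Tr × ℕ} : e ∈ used (lifts n PV PU) ↔
    (∃ u : Tr, u.numNodes < n ∧ ∃ e' ∈ used (PV u), e = liftRight u e') ∨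
    (∃ v : Tr, v.numNodes < n ∧ rep v = v ∧ ∃ e' ∈ used (PU v), e = liftLeft v e') := by
  constructor
  · rintro ⟨h, ⟨u, hu, k, hk, rfl⟩ | ⟨v, hv, hv', k, hk, rfl⟩, he⟩
    · obtain ⟨e', he', rfl⟩ := List.mem_map.1 he
      exact Or.inl ⟨u, hu, e', ⟨k, hk, he'⟩, rfl⟩
    · rw [(turn_perm _).mem_iff] at he
      obtain ⟨e', he', rfl⟩ := List.mem_map.1 he
      exact Or.inr ⟨v, hv, hv', e', ⟨k, hk, he'⟩, rfl⟩
  · rintro (⟨u, hu, e', ⟨k, hk, he'⟩, rfl⟩ | ⟨v, hv, hv', e', ⟨k, hk, he'⟩, rfl⟩)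
    · exact ⟨_, Or.inl ⟨u, hu, k, hk, rfl⟩, List.mem_map.2 ⟨e', he', rfl⟩⟩
    · exact ⟨_, Or.inr ⟨v, hv, hv', k, hk, rfl⟩,
        (turn_perm _).mem_iff.2 (List.mem_map.2 ⟨e', he', rfl⟩)⟩

lemma IsScheme.lt_of_mem_used {P : Set (List (Tr × ℕ))} (hP : IsScheme n P) {e : Tr × ℕ}
    (he : e ∈ used P) : e.1.numNodes = n ∧ e.2 < 2 * n := by
  obtain ⟨h, hh, he⟩ := he
  exact hP.order h hh e he

lemma isScheme_lifts (hPV : ∀ u : Tr, u.numNodes < n → IsScheme (n - 1 - u.numNodes) (PV u))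
    (hPV' : ∀ u : Tr, u.numNodes < n → n - 1 - u.numNodes = 2 → PV u = ∅)
    (hPU : ∀ v : Tr, v.numNodes < n → IsScheme (n - 1 - v.numNodes) (PU v)) :
    IsScheme n (lifts n PV PU) where
  order := by
    intro h hh e he
    rcases mem_used_lifts.1 ⟨h, hh, he⟩ with ⟨u, hu, e', he', rfl⟩ | ⟨v, hv, hv', e', he', rfl⟩
    · have := (hPV u hu).lt_of_mem_used he'
      simp only [liftRight, numNodes_node]
      omega
    · have := (hPU v hv).lt_of_mem_used he'
      simp only [liftLeft, numNodes_node]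
      omega
  two_le := by
    rintro h (⟨u, hu, k, hk, rfl⟩ | ⟨v, hv, hv', k, hk, rfl⟩)
    · simpa using (hPV u hu).two_le k hk
    · simpa [(turn_perm _).length_eq] using (hPU v hv).two_le k hk
  cyclic := by
    rintro h (⟨u, hu, k, hk, rfl⟩ | ⟨v, hv, hv', k, hk, rfl⟩)
    · refine ((hPV u hu).cyclic k hk).map fun e e' h => ?_
      simp only [liftRight, lo_right, up_right]
      exact ((h.cons _).append_left _).cons _
    · refine Cyclic.turn (Cyclic.map (fun e e' h => ?_)
        (((hPU v hv).cyclic k hk).and (S := fun e e' => e.2 < 2 * e.1.numNodes ∧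
          e'.2 < 2 * e'.1.numNodes) ?_))
      · obtain ⟨h, h1, h2⟩ := h
        simp only [liftLeft]
        rw [lo_left _ _ h1, up_left _ _ h2]
        exact (h.compl.append_right _).cons _
      · intro a ha b hb
        have := (hPU v hv).order k hk a ha
        have := (hPU v hv).order k hk b hb
        omega
  disjoint := by
    rintro h (⟨u, hu, k, hk, rfl⟩ | ⟨v, hv, hv', k, hk, rfl⟩) h'
      (⟨u', hu', k', hk', rfl⟩ | ⟨w, hw, hw', k', hk', rfl⟩) x hx hx'
    · obtain ⟨e, he, rfl⟩ := List.mem_map.1 hx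
      obtain ⟨e', he', h'⟩ := List.mem_map.1 hx'
      simp only [liftRight, Prod.mk.injEq, node.injEq] at h'
      obtain ⟨⟨-, rfl, h1⟩, h2⟩ := h'
      obtain rfl : e' = e := Prod.ext h1 (by omega)
      rw [(hPV u' hu).disjoint k hk k' hk' e' he he']
    · rw [(turn_perm _).mem_iff] at hx'
      obtain ⟨e, he, rfl⟩ := List.mem_map.1 hx
      obtain ⟨e', he', h'⟩ := List.mem_map.1 hx'
      simp only [liftRight, liftLeft, Prod.mk.injEq, node.injEq] at h'
      obtain ⟨⟨-, h1, -⟩, h2⟩ := h'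
      rw [h1] at h2
      omega
    · rw [(turn_perm _).mem_iff] at hx
      obtain ⟨e, he, rfl⟩ := List.mem_map.1 hx
      obtain ⟨e', he', h'⟩ := List.mem_map.1 hx'
      simp only [liftRight, liftLeft, Prod.mk.injEq, node.injEq] at h'
      obtain ⟨⟨-, h1, -⟩, h2⟩ := h'
      rw [h1] at h2
      omega
    · rw [(turn_perm _).mem_iff] at hx hx'
      obtain ⟨e, he, rfl⟩ := List.mem_map.1 hx
      obtain ⟨e', he', h'⟩ := List.mem_map.1 hx'
      simp only [liftLeft, Prod.mk.injEq, node.injEq] at h'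
      obtain ⟨⟨-, h1, rfl⟩, h2⟩ := h'
      have o1 := (hPU w hw).order k hk e he
      have o2 := (hPU w hw).order k' hk' e' he'
      obtain rfl : e' = e := Prod.ext h1 (by rw [h1] at h2; omega)
      rw [(hPU w hw).disjoint k hk k' hk' e' he he']
  forest := by
    classical
    set T : Finset Tr := (Finset.range n).biUnion treesOfNumNodesEq with hT
    have hT' : ∀ u : Tr, u ∈ T ↔ u.numNodes < n := by
      intro u
      simp [hT]
    have h1 := forest_liftRight (PV := PV) T fun u hu => (hPV u ((hT' u).1 hu)).forest
    have h2 := forest_liftLeft (PU := PU) h1 ?_ (T.filter fun v => rep v = v)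
      (fun v hv => (hPU v ((hT' v).1 (Finset.mem_filter.1 hv).1)).forest)
      (fun v hv => (Finset.mem_filter.1 hv).2)
    · convert h2 using 1
      simp only [lifts, Finset.mem_filter, hT', and_assoc]
    · rintro h ⟨u, hu, k, hk, rfl⟩ e he e' he'
      rw [hT'] at hu
      obtain ⟨d, hd, rfl⟩ := List.mem_map.1 he
      obtain ⟨d', hd', rfl⟩ := List.mem_map.1 he'
      refine ⟨u, d.1, d'.1, rfl, rfl, ?_⟩
      have o1 := (hPV u hu).order k hk d hd
      have o2 := (hPV u hu).order k hk d' hd'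
      have : n - 1 - u.numNodes ≠ 2 := fun h => by
        rw [hPV' u hu h] at hk
        exact hk
      rw [rep_of_ne (by omega), rep_of_ne (by omega), o1.1, o2.1]

/-- The lifted schemes connect every tree to its representative. -/
lemma eq_pairRep_of_constOn_lifts
    (hPV : ∀ u : Tr, u.numNodes < n → n - 1 - u.numNodes ≠ 2 → Connects (n - 1 - u.numNodes) (PV u))
    (hPU : ∀ v : Tr, v.numNodes < n → n - 1 - v.numNodes ≠ 2 → Connects (n - 1 - v.numNodes) (PU v))
    {f : Tr → Prop} (hf : ConstOn (fun e => f e.1) (lifts n PV PU)) {t : Tr} (ht : t.numNodes = n)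
    (hn : n ≠ 0) : f t = f (pairRep t) := by
  cases t with
  | nil => exact absurd ht.symm hn
  | node x u v =>
    change (u △ v).numNodes = n at ht
    change f (u △ v) = f (rep u △ rep v)
    rw [numNodes_node] at ht
    have h1 : f (u △ v) = f (u △ rep v) := by
      by_cases hv : v.numNodes = 2
      · rw [rep_of_eq hv]
      · refine hPV u (by omega) (by omega) (fun v => f (u △ v)) ?_ v (rep v) (by omega)
          (by rw [numNodes_rep]; omega)
        intro k hk e he e' he'
        exact hf _ (Or.inl ⟨u, by omega, k, hk, rfl⟩) _ (List.mem_map.2 ⟨e, he, rfl⟩) _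
          (List.mem_map.2 ⟨e', he', rfl⟩)
    rw [h1]
    by_cases hu : u.numNodes = 2
    · rw [rep_of_eq hu]
    · refine hPU (rep v) (by rw [numNodes_rep]; omega) (by rw [numNodes_rep]; omega)
        (fun u => f (u △ rep v)) ?_ u (rep u) (by rw [numNodes_rep]; omega)
        (by rw [numNodes_rep, numNodes_rep]; omega)
      intro k hk e he e' he'
      exact hf _ (Or.inr ⟨rep v, by rw [numNodes_rep]; omega, rep_rep v, k, hk, rfl⟩) _
        ((turn_perm _).mem_iff.2 (List.mem_map.2 ⟨e, he, rfl⟩)) _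
        ((turn_perm _).mem_iff.2 (List.mem_map.2 ⟨e', he', rfl⟩))

end Lifts

end OddGraph

namespace OddGraph

open BinaryTree

/-! ### Linking the components of a scheme -/

section Chain

/-- The `κ`-images of the trees of the polygons in a list. -/
def labels (κ : Tr → Tr) (L : List (List (Tr × ℕ))) : List Tr := L.flatten.map fun e => κ e.1

/-- A polygon meets pairwise different components, which are represented by the values of `κ`. Its
first edge belongs to an old component, the others belong to components not met by `L`. -/
structure IsLink (κ : Tr → Tr) (n : ℕ) (L : List (List (Tr × ℕ))) (h : List (Tr × ℕ)) : Prop where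
  order : ∀ e ∈ h, e.1.numNodes = n ∧ e.2 < 2 * n
  two_le : 2 ≤ h.length
  cyclic : Cyclic (fun e e' => Flip (lo e'.1 e'.2) (up e.1 e.2)) h
  nodup : (h.map fun e => κ e.1).Nodup
  head_not_mem : ∀ e ∈ h.head?, e ∉ L.flatten
  head_mem : L = [] ∨ ∀ e ∈ h.head?, κ e.1 ∈ labels κ L
  tail_not_mem : ∀ e ∈ h.tail, κ e.1 ∉ labels κ L

/-- A list of polygons, the last one first, that are attached one by one. -/
inductive LinkChain (κ : Tr → Tr) (n : ℕ) : List (List (Tr × ℕ)) → Prop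
  | empty : LinkChain κ n []
  | cons {h : List (Tr × ℕ)} {L : List (List (Tr × ℕ))} (hL : LinkChain κ n L)
      (hh : IsLink κ n L h) : LinkChain κ n (h :: L)

variable {κ : Tr → Tr} {n : ℕ} {L : List (List (Tr × ℕ))}

lemma mem_labels {x : Tr} : x ∈ labels κ L ↔ ∃ e ∈ L.flatten, κ e.1 = x := by
  simp only [labels, List.mem_map]

lemma used_setOf_mem : used {h | h ∈ L} = {e | e ∈ L.flatten} := by
  ext e
  simp [used, List.mem_flatten]

lemma used_union (P Q : Set (List (Tr × ℕ))) : used (P ∪ Q) = used P ∪ used Q := by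
  ext e
  simp only [used, Set.mem_union, Set.mem_ofPred_eq]
  constructor
  · rintro ⟨h, h1 | h1, h2⟩
    exacts [Or.inl ⟨h, h1, h2⟩, Or.inr ⟨h, h1, h2⟩]
  · rintro (⟨h, h1, h2⟩ | ⟨h, h1, h2⟩)
    exacts [⟨h, Or.inl h1, h2⟩, ⟨h, Or.inr h1, h2⟩]

lemma LinkChain.order (hL : LinkChain κ n L) : ∀ e ∈ L.flatten, e.1.numNodes = n ∧ e.2 < 2 * n := by
  induction hL with
  | empty => simp
  | cons hL hh ih =>
    intro e he
    rw [List.flatten_cons, List.mem_append] at he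
    exact he.elim (hh.order e) (ih e)

/-- Links can be added to a scheme. -/
theorem LinkChain.isScheme {P : Set (List (Tr × ℕ))} (hP : IsScheme n P) (hn : n ≠ 0)
    (hκ : ∀ t, t ≠ nil → κ t ≠ nil) (hκP : ConstOn (fun e => κ e.1) P) (hL : LinkChain κ n L)
    (hd : ∀ e ∈ L.flatten, e ∉ used P) : IsScheme n (P ∪ {h | h ∈ L}) := by
  induction hL with
  | empty => simpa using hP
  | @cons h L hL hh ih =>
    have ih := ih fun e he => hd e (by simp only [List.flatten_cons, List.mem_append, he, or_true])
    have hset : P ∪ {k | k ∈ h :: L} = insert h (P ∪ {k | k ∈ L}) := by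
      ext k
      simp only [List.mem_cons, Set.mem_union, Set.mem_ofPred_eq, Set.mem_insert_iff]
      tauto
    have hnew : ∀ e ∈ h, e ∉ used (P ∪ {k | k ∈ L}) := by
      intro e he
      rw [used_union, used_setOf_mem]
      rintro (h1 | h1)
      · exact hd e (by simp only [List.flatten_cons, List.mem_append, he, true_or]) h1
      · cases h with
        | nil => simp at he
        | cons d l =>
          rcases List.mem_cons.1 he with rfl | he
          · exact hh.head_not_mem e rfl h1
          · exact hh.tail_not_mem e he (mem_labels.2 ⟨e, h1, rfl⟩)
    rw [hset]
    constructor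
    · rintro k (rfl | hk)
      exacts [hh.order, ih.order k hk]
    · rintro k (rfl | hk)
      exacts [hh.two_le, ih.two_le k hk]
    · rintro k (rfl | hk)
      exacts [hh.cyclic, ih.cyclic k hk]
    · rintro k (rfl | hk) k' (rfl | hk') e he he'
      · rfl
      · exact (hnew e he ⟨k', hk', he'⟩).elim
      · exact (hnew e he' ⟨k, hk, he⟩).elim
      · exact ih.disjoint k hk k' hk' e he he'
    · refine Forest.insert (fun x => if κ x ∈ labels κ L then nil else κ x) ih.forest ?_ ?_
      · rintro k (hk | hk) e he e' he'
        · simp only [hκP k hk e he e' he']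
        · have : ∀ e ∈ k, κ e.1 ∈ labels κ L := fun e he =>
            mem_labels.2 ⟨e, List.mem_flatten.2 ⟨k, hk, he⟩, rfl⟩
          simp only [this e he, this e' he', if_true]
      · cases h with
        | nil => simp
        | cons d l =>
          have hnd := hh.nodup
          rw [List.map_cons, List.nodup_cons] at hnd ⊢
          have hl : (l.map fun e => if κ e.1 ∈ labels κ L then nil else κ e.1) =
              l.map fun e => κ e.1 :=
            List.map_congr_left fun e he => if_neg (hh.tail_not_mem e he)
          rw [hl]
          refine ⟨?_, hnd.2⟩
          split_ifs
          · intro h0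
            obtain ⟨e, he, h0⟩ := List.mem_map.1 h0
            refine hκ e.1 (fun h1 => ?_) h0
            have := (hh.order e (List.mem_cons_of_mem _ he)).1
            rw [h1] at this
            exact hn this.symm
          · exact hnd.1

/-- The components met by a chain are connected. -/
lemma LinkChain.eq (hL : LinkChain κ n L) {f : Tr → Prop}
    (hf : ConstOn (fun e => f e.1) {h | h ∈ L}) (hfκ : ∀ t, t.numNodes = n → f t = f (κ t)) :
    ∀ e ∈ L.flatten, ∀ e' ∈ L.flatten, f e.1 = f e'.1 := by
  induction hL with
  | empty => simp
  | @cons h L hL hh ih =>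
    have ih := ih fun k hk => hf k (List.mem_cons_of_mem _ hk)
    have hfh := hf h (by simp)
    rcases hh.head_mem with rfl | hm
    · simpa using hfh
    · cases h with
      | nil => simpa using ih
      | cons d l =>
        obtain ⟨a, ha, ha'⟩ := mem_labels.1 (hm d rfl)
        have hda : f d.1 = f a.1 := by
          rw [hfκ _ (hh.order d (by simp)).1, ← ha', ← hfκ _ (hL.order a ha).1]
        have key : ∀ e ∈ ((d :: l) :: L).flatten, f e.1 = f a.1 := by
          intro e he
          rw [List.flatten_cons, List.mem_append] at he
          rcases he with he | he
          · exact (hfh e he d (by simp)).trans hda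
          · exact ih e he a ha
        exact fun e he e' he' => (key e he).trans (key e' he').symm

lemma LinkChain.connects {P : Set (List (Tr × ℕ))} (hL : LinkChain κ n L)
    (hP : ∀ f : Tr → Prop, ConstOn (fun e => f e.1) P → ∀ t, t.numNodes = n → f t = f (κ t))
    (hc : ∀ t, t.numNodes = n → κ t ∈ labels κ L) : Connects n (P ∪ {h | h ∈ L}) := by
  intro f hf t t' ht ht'
  have hfκ := hP f fun h hh => hf h (Or.inl hh)
  have h1 := hL.eq (fun h hh => hf h (Or.inr hh)) hfκ
  obtain ⟨e, he, h2⟩ := mem_labels.1 (hc t ht)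
  obtain ⟨e', he', h3⟩ := mem_labels.1 (hc t' ht')
  rw [hfκ t ht, hfκ t' ht', ← h2, ← h3, ← hfκ _ (hL.order e he).1, ← hfκ _ (hL.order e' he').1]
  exact h1 e he e' he'

end Chain

section Retained

/-- A comb, or the tree with the Dyck word `101100`. -/
def CombLike (t : Tr) : Prop := t = comb t.numNodes ∨ t = nil △ main 2

/-- Path edges that the polygons of a scheme must avoid, because they are needed in the recursion:
the links for more nodes use edges that lie over these ones, both from the left and from the right
subtree. The conditions are such that they reproduce themselves in the recursion. -/
def Retained (e : Tr × ℕ) : Prop :=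
  (CombLike e.1 ∧ e.2 = 0) ∨
  (e.1.left ≠ comb 2 ∧ e.1.right ≠ nil ∧ CombLike e.1.right ∧ e.2 = 2 * e.1.left.numNodes + 2) ∨
  (e.1.left = nil ∧ 3 ≤ e.1.right.numNodes ∧ e.2 = 1) ∨
  (e.1.left = comb 1 ∧ e.1.right ≠ nil ∧ e.1.right.left = nil ∧ e.2 = 2) ∨
  e = (comb 1 △ comb 1, 1)

/-- A scheme that connects all trees with `n` nodes, for `n ≠ 2`, and can be used in the
recursion. -/
structure IsGood (n : ℕ) (P : Set (List (Tr × ℕ))) : Prop where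
  scheme : IsScheme n P
  connects : n ≠ 2 → Connects n P
  eq_empty : n ≤ 2 → P = ∅
  not_retained : ∀ e ∈ used P, ¬ Retained e

lemma exists_node {n : ℕ} {t : Tr} (h : t.numNodes = n + 1) :
    ∃ u v : Tr, t = u △ v ∧ u.numNodes + v.numNodes = n := by
  cases t with
  | nil => simp at h
  | node _ u v => exact ⟨u, v, rfl, by simpa using h⟩

lemma eq_nil_of_numNodes {t : Tr} (h : t.numNodes = 0) : t = nil := by
  cases t with
  | nil => rfl
  | node _ u v => simp at h

lemma eq_comb_one_of_numNodes {t : Tr} (h : t.numNodes = 1) : t = comb 1 := by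
  obtain ⟨u, v, rfl, h⟩ := exists_node h
  rw [eq_nil_of_numNodes (t := u) (by omega), eq_nil_of_numNodes (t := v) (by omega)]
  rfl

lemma eq_of_numNodes_eq_two {t : Tr} (h : t.numNodes = 2) : t = comb 2 ∨ t = main 2 := by
  obtain ⟨u, v, rfl, h⟩ := exists_node h
  rcases Nat.eq_zero_or_pos u.numNodes with h0 | h0
  · rw [eq_nil_of_numNodes h0, eq_comb_one_of_numNodes (t := v) (by omega)]
    exact Or.inl rfl
  · rw [eq_comb_one_of_numNodes (t := u) (by omega), eq_nil_of_numNodes (t := v) (by omega)]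
    exact Or.inr rfl

lemma isGood_empty {n : ℕ} (hn : n ≤ 2) : IsGood n ∅ where
  scheme := ⟨by simp, by simp, by simp, by simp, Forest.empty⟩
  connects := by
    intro h f _ t t' ht ht'
    have : n = 0 ∨ n = 1 := by omega
    rcases this with rfl | rfl
    · rw [eq_nil_of_numNodes ht, eq_nil_of_numNodes ht']
    · rw [eq_comb_one_of_numNodes ht, eq_comb_one_of_numNodes ht']
  eq_empty _ := rfl
  not_retained := by simp [used]

/-- The edge is neither retained nor used by a lifted polygon: if it lies over an edge of a subtree
that can occur in a lifted polygon at all, then this edge is retained. No polygon has edges on trees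
with less than three nodes, and left lifts have representatives as right subtrees. -/
structure IsFree (e : Tr × ℕ) : Prop where
  not_retained : ¬ Retained e
  right : 2 * e.1.left.numNodes + 2 ≤ e.2 →
    e.1.right.numNodes ≤ 2 ∨ Retained (e.1.right, e.2 - (2 * e.1.left.numNodes + 2))
  left : 1 ≤ e.2 → e.2 ≤ 2 * e.1.left.numNodes → rep e.1.right = e.1.right →
    e.1.left.numNodes ≤ 2 ∨ Retained (e.1.left, 2 * e.1.left.numNodes - e.2)

/-- Links for the lifted schemes, which connect all components and share no edge with the lifts. -/
structure IsLinking (n : ℕ) (L : List (List (Tr × ℕ))) : Prop where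
  chain : LinkChain pairRep n L
  mem_labels : ∀ t : Tr, t.numNodes = n → pairRep t ∈ labels pairRep L
  free : ∀ e ∈ L.flatten, IsFree e

variable {n : ℕ} {PV PU : Tr → Set (List (Tr × ℕ))} {L : List (List (Tr × ℕ))}

lemma IsGood.not_mem_used_of_le {P : Set (List (Tr × ℕ))} (hP : IsGood n P) (hn : n ≤ 2)
    (e : Tr × ℕ) : e ∉ used P := by
  rw [hP.eq_empty hn]
  simp [used]

lemma IsLinking.not_mem_used (hL : IsLinking n L)
    (hPV : ∀ u : Tr, u.numNodes < n → IsGood (n - 1 - u.numNodes) (PV u))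
    (hPU : ∀ v : Tr, v.numNodes < n → IsGood (n - 1 - v.numNodes) (PU v)) :
    ∀ e ∈ L.flatten, e ∉ used (lifts n PV PU) := by
  intro e he h
  rcases mem_used_lifts.1 h with ⟨u, hu, e', he', rfl⟩ | ⟨v, hv, hv', e', he', rfl⟩
  · have o := (hPV u hu).scheme.lt_of_mem_used he'
    rcases (hL.free _ he).right (by simp [liftRight]) with h | h
    · simp only [liftRight, right] at h
      exact (hPV u hu).not_mem_used_of_le (by omega) _ he'
    · simp only [liftRight, right, left, Nat.add_sub_cancel_left] at h
      exact (hPV u hu).not_retained _ he' h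
  · have o := (hPU v hv).scheme.lt_of_mem_used he'
    rcases (hL.free _ he).left (by simp [liftLeft]; omega) (by simp [liftLeft])
      (by simpa [liftLeft] using hv') with h | h
    · simp only [liftLeft, left] at h
      exact (hPU v hv).not_mem_used_of_le (by omega) _ he'
    · simp only [liftLeft, left] at h
      rw [show 2 * e'.1.numNodes - (2 * e'.1.numNodes - e'.2) = e'.2 by omega] at h
      exact (hPU v hv).not_retained _ he' h

/-- The recursion: lifted schemes together with links form a scheme of higher order. -/
theorem IsLinking.isGood (hn : 3 ≤ n) (hL : IsLinking n L)
    (hPV : ∀ u : Tr, u.numNodes < n → IsGood (n - 1 - u.numNodes) (PV u))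
    (hPU : ∀ v : Tr, v.numNodes < n → IsGood (n - 1 - v.numNodes) (PU v)) :
    IsGood n (lifts n PV PU ∪ {h | h ∈ L}) where
  scheme := by
    refine LinkChain.isScheme (κ := pairRep) (isScheme_lifts (fun u hu => (hPV u hu).scheme)
      (fun u hu h => (hPV u hu).eq_empty h.le) (fun v hv => (hPU v hv).scheme)) (by omega) ?_ ?_
      hL.chain (hL.not_mem_used hPV hPU)
    · intro t ht
      cases t with
      | nil => exact absurd rfl ht
      | node x u v => simp [pairRep]
    · have hrep : ∀ {m : ℕ} {P : Set (List (Tr × ℕ))}, IsGood m P → ∀ k ∈ P, ∀ e ∈ k, ∀ e' ∈ k,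
          rep e.1 = rep e'.1 := by
        intro m P hP k hk e he e' he'
        have o1 := hP.scheme.order k hk e he
        have o2 := hP.scheme.order k hk e' he'
        have : ¬ m ≤ 2 := fun h => by
          rw [hP.eq_empty h] at hk
          exact hk
        rw [rep_of_ne (by omega), rep_of_ne (by omega), o1.1, o2.1]
      rintro h (⟨u, hu, k, hk, rfl⟩ | ⟨v, hv, hv', k, hk, rfl⟩) x hx x' hx'
      · obtain ⟨e, he, rfl⟩ := List.mem_map.1 hx
        obtain ⟨e', he', rfl⟩ := List.mem_map.1 hx'
        simp [liftRight, hrep (hPV u hu) k hk e he e' he']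
      · rw [(turn_perm _).mem_iff] at hx hx'
        obtain ⟨e, he, rfl⟩ := List.mem_map.1 hx
        obtain ⟨e', he', rfl⟩ := List.mem_map.1 hx'
        simp [liftLeft, hrep (hPU v hv) k hk e he e' he']
  connects := fun _ => hL.chain.connects (fun f hf t ht =>
    eq_pairRep_of_constOn_lifts (fun u hu h => (hPV u hu).connects h)
      (fun v hv h => (hPU v hv).connects h) hf ht (by omega)) hL.mem_labels
  eq_empty := by omega
  not_retained := by
    intro x hx
    rw [used_union, used_setOf_mem] at hx
    rcases hx with hx | hx
    · rcases mem_used_lifts.1 hx with ⟨u, hu, e, he, rfl⟩ | ⟨v, hv, hv', e, he, rfl⟩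
      · have o := (hPV u hu).scheme.lt_of_mem_used he
        rintro (h | h | h | h | h)
        · simp [liftRight] at h
        · simp only [liftRight, left, right] at h
          exact (hPV u hu).not_retained e he (Or.inl ⟨h.2.2.1, by omega⟩)
        · simp only [liftRight, left, right] at h
          omega
        · simp only [liftRight, left, right] at h
          rw [h.1, numNodes_comb] at h
          omega
        · simp only [liftRight, Prod.mk.injEq] at h
          omega
      · have o := (hPU v hv).scheme.lt_of_mem_used he
        have h3 : 3 ≤ e.1.numNodes := by
          by_contra h3
          exact (hPU v hv).not_mem_used_of_le (by omega) e he
        rintro (h | h | h | h | h)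
        · simp only [liftLeft] at h
          omega
        · simp only [liftLeft, left] at h
          omega
        · simp only [liftLeft, left] at h
          rw [h.1] at h3
          simp at h3
        · simp only [liftLeft, left] at h
          rw [h.1] at h3
          simp at h3
        · simp only [liftLeft, Prod.mk.injEq, node.injEq] at h
          rw [h.1.2.1] at h3
          simp at h3
    · exact (hL.free x hx).not_retained

end Retained

section SmallOrders

/-- A Boolean test for `Flip`. -/
def flipTest : List Bool → List Bool → Bool
  | false :: x, true :: y => x == y
  | false :: x, false :: y => flipTest x y
  | true :: x, true :: y => flipTest x y
  | _, _ => false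

lemma flip_of_flipTest : ∀ {x y : List Bool}, flipTest x y = true → Flip x y
  | false :: x, true :: y, h => by
    have : x = y := by simpa [flipTest] using h
    rw [this]
    exact Flip.head y
  | false :: x, false :: y, h => (flip_of_flipTest (x := x) (y := y) h).cons _
  | true :: x, true :: y, h => (flip_of_flipTest (x := x) (y := y) h).cons _
  | [], _, h => by simp [flipTest] at h
  | _ :: _, [], h => by simp [flipTest] at h
  | true :: _, false :: _, h => by simp [flipTest] at h

lemma Cyclic.of_flipTest {h : List (Tr × ℕ)}
    (hh : Cyclic (fun e e' : Tr × ℕ => flipTest (lo e'.1 e'.2) (up e.1 e.2) = true) h) :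
    Cyclic (fun e e' => Flip (lo e'.1 e'.2) (up e.1 e.2)) h := by
  have := hh.map (f := id) (S := fun e e' : Tr × ℕ => Flip (lo e'.1 e'.2) (up e.1 e.2))
    fun a b h => flip_of_flipTest h
  simpa using this

instance (t : Tr) : Decidable (CombLike t) :=
  inferInstanceAs (Decidable (t = comb t.numNodes ∨ t = nil △ main 2))

instance (e : Tr × ℕ) : Decidable (Retained e) := by
  unfold Retained
  infer_instance

instance decidableChainRel (R : Tr × ℕ → Tr × ℕ → Prop) [DecidableRel R] : ∀ (l : List (Tr × ℕ)) (d d₀ : Tr × ℕ),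
    Decidable (ChainRel R d l d₀)
  | [], d, d₀ => inferInstanceAs (Decidable (R d d₀))
  | d' :: l, d, d₀ =>
    have : Decidable (ChainRel R d' l d₀) := decidableChainRel R l d' d₀
    inferInstanceAs (Decidable (R d d' ∧ ChainRel R d' l d₀))

instance (R : Tr × ℕ → Tr × ℕ → Prop) [DecidableRel R] : ∀ l : List (Tr × ℕ), Decidable (Cyclic R l)
  | [] => isTrue trivial
  | d :: l => inferInstanceAs (Decidable (ChainRel R d l d))

/-- Links for the trees with three nodes, each of which is a component of its own. -/
def links₃ : List (List (Tr × ℕ)) :=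
   [[(main 3, 0), (nil △ main 2, 4), (comb 3, 1)],
    [(main 3, 2), (comb 1 △ comb 1, 5), (comb 2 △ nil, 5)]]

/-- Links for the trees with four nodes. They replace lifts altogether, since the trees with two
nodes, which occur as subtrees, have no connecting scheme. -/
def links₄ : List (List (Tr × ℕ)) :=
   [[(nil △ (comb 1 △ comb 1), 0), (comb 2 △ comb 1, 0), (main 2 △ comb 1, 3)],
    [(nil △ main 3, 2), (nil △ (nil △ main 2), 6), (comb 4, 3)],
    [(nil △ (comb 2 △ nil), 2), (nil △ main 3, 6), (nil △ (comb 1 △ comb 1), 3)],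
    [((comb 1 △ comb 1) △ nil, 7), ((comb 2 △ nil) △ nil, 3), (comb 1 △ main 2, 6)],
    [((comb 1 △ comb 1) △ nil, 3), (nil △ (comb 2 △ nil), 6), (comb 3 △ nil, 7)],
    [(main 4, 2), (comb 1 △ comb 2, 7), ((nil △ main 2) △ nil, 7), ((comb 1 △ comb 1) △ nil, 4)]]

lemma eq_of_numNodes_eq_three {t : Tr} (h : t.numNodes = 3) :
    t ∈ [nil △ comb 2, nil △ main 2, comb 1 △ comb 1, comb 2 △ nil, main 2 △ nil] := by
  obtain ⟨u, v, rfl, h⟩ := exists_node h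
  have : u.numNodes = 0 ∨ u.numNodes = 1 ∨ u.numNodes = 2 := by omega
  rcases this with hu | hu | hu
  · rw [eq_nil_of_numNodes hu]
    rcases eq_of_numNodes_eq_two (t := v) (by omega) with rfl | rfl <;> simp
  · rw [eq_comb_one_of_numNodes hu, eq_comb_one_of_numNodes (t := v) (by omega)]
    simp
  · rw [eq_nil_of_numNodes (t := v) (by omega)]
    rcases eq_of_numNodes_eq_two hu with rfl | rfl <;> simp

lemma mem_labels_links₃ {t : Tr} (h : t.numNodes = 3) : t ∈ labels id links₃ := by
  have key : ∀ t ∈ [nil △ comb 2, nil △ main 2, comb 1 △ comb 1, comb 2 △ nil, main 2 △ nil],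
      t ∈ labels id links₃ := by decide
  exact key t (eq_of_numNodes_eq_three h)

lemma mem_labels_links₄ {t : Tr} (h : t.numNodes = 4) : t ∈ labels id links₄ := by
  obtain ⟨u, v, rfl, h⟩ := exists_node h
  have k3 : ∀ t ∈ [nil △ comb 2, nil △ main 2, comb 1 △ comb 1, comb 2 △ nil, main 2 △ nil],
      nil △ t ∈ labels id links₄ ∧ t △ nil ∈ labels id links₄ := by decide
  have k2 : ∀ t ∈ [comb 2, main 2],
      comb 1 △ t ∈ labels id links₄ ∧ t △ comb 1 ∈ labels id links₄ := by decide
  have : u.numNodes = 0 ∨ u.numNodes = 1 ∨ u.numNodes = 2 ∨ u.numNodes = 3 := by omega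
  rcases this with hu | hu | hu | hu
  · rw [eq_nil_of_numNodes hu]
    exact (k3 v (eq_of_numNodes_eq_three (by omega))).1
  · rw [eq_comb_one_of_numNodes hu]
    exact (k2 v (by simpa using eq_of_numNodes_eq_two (by omega))).1
  · rw [eq_comb_one_of_numNodes (t := v) (by omega)]
    exact (k2 u (by simpa using eq_of_numNodes_eq_two hu)).2
  · rw [eq_nil_of_numNodes (t := v) (by omega)]
    exact (k3 u (eq_of_numNodes_eq_three hu)).2

lemma linkChain₃ : LinkChain id 3 links₃ := by
  refine .cons (.cons .empty ?_) ?_ <;>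
    exact ⟨by decide, by decide, Cyclic.of_flipTest (by decide), by decide, by decide, by decide,
      by decide⟩

lemma linkChain₄ : LinkChain id 4 links₄ := by
  refine .cons (.cons (.cons (.cons (.cons (.cons .empty ?_) ?_) ?_) ?_) ?_) ?_ <;>
    exact ⟨by decide, by decide, Cyclic.of_flipTest (by decide), by decide, by decide, by decide,
      by decide⟩

lemma LinkChain.isGood (hn : 3 ≤ n) (hL : LinkChain id n L)
    (hc : ∀ t : Tr, t.numNodes = n → t ∈ labels id L) (hr : ∀ e ∈ L.flatten, ¬ Retained e) :
    IsGood n {h | h ∈ L} := by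
  have h0 : IsScheme n ∅ := ⟨by simp, by simp, by simp, by simp, Forest.empty⟩
  have := LinkChain.isScheme h0 (by omega) (by simp) (by simp [ConstOn]) hL (by simp [used])
  have hconn := hL.connects (P := ∅) (by simp) (by simpa using hc)
  rw [Set.empty_union] at this hconn
  refine ⟨this, fun _ => hconn, by omega, ?_⟩
  rw [used_setOf_mem]
  exact hr

lemma isGood₃ : IsGood 3 {h | h ∈ links₃} :=
  linkChain₃.isGood le_rfl (fun _ => mem_labels_links₃) (by decide)

lemma isGood₄ : IsGood 4 {h | h ∈ links₄} :=
  linkChain₄.isGood (by decide) (fun _ => mem_labels_links₄) (by decide)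

end SmallOrders

end OddGraph

namespace OddGraph

open BinaryTree

/-! ### The linking polygons -/

section Words

variable {u v : Tr} {s s' : ℕ}

lemma lo_eq_left (h : s' < 2 * u.numNodes) (hs : s = 2 * u.numNodes - s') :
    lo (u △ v) s = true :: (compl (up u s') ++ true :: word v) := by rw [hs, lo_left u v h]

lemma up_eq_left (h : s' < 2 * u.numNodes) (hs : s = 2 * u.numNodes - s') :
    up (u △ v) s = true :: (compl (lo u s') ++ true :: word v) := by rw [hs, up_left u v h]

lemma lo_eq_mid (hs : s = 2 * u.numNodes + 1) :
    lo (u △ v) s = false :: (compl (word u) ++ true :: word v) := by rw [hs, lo_mid]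

lemma up_eq_mid (hs : s = 2 * u.numNodes + 1) :
    up (u △ v) s = true :: (compl (word u) ++ true :: word v) := by rw [hs, up_mid]

lemma lo_eq_right (hs : s = 2 * u.numNodes + 2 + s') :
    lo (u △ v) s = false :: (compl (word u) ++ true :: lo v s') := by rw [hs, lo_right]

lemma up_eq_right (hs : s = 2 * u.numNodes + 2 + s') :
    up (u △ v) s = false :: (compl (word u) ++ true :: up v s') := by rw [hs, up_right]

end Words

section Polygons

/-- The 6-gon through the paths of `10 1z0 10v`, `1 11z00 0 v` and `1 10z 0 10v`. It joins the trees
with an empty left subtree to two consecutive sizes of left subtrees. -/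
def hexagon (z v : Tr) : List (Tr × ℕ) :=
  [(nil △ (z △ (nil △ v)), 2 * z.numNodes + 4), (((z △ nil) △ nil) △ v, 2 * z.numNodes + 5),
    ((nil △ z) △ (nil △ v), 2 * z.numNodes + 1)]

/-- The 6-gon through the paths of `1 1100z 0 10v`, `1100 1z0 10v` and `1 1101z00 0 v`. It reaches
the trees with one node in the left subtree. -/
def shiftedHexagon (z v : Tr) : List (Tr × ℕ) :=
  [((comb 1 △ z) △ (nil △ v), 2 * z.numNodes + 3), (comb 1 △ (z △ (nil △ v)), 2 * z.numNodes + 6),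
    (((nil △ (z △ nil)) △ nil) △ v, 2 * z.numNodes + 7)]

/-- The 6-gon through the paths of `110100v`, `111000v` and `101100v`. It joins the trees with an
empty left subtree to both left subtrees with two nodes. -/
def baseHexagon (v : Tr) : List (Tr × ℕ) :=
  [(comb 2 △ v, 0), (main 2 △ v, 3), (nil △ (comb 1 △ v), 0)]

/-- The 8-gon through the paths of `10110010v`, `11010010v`, `11011000v` and `11100010v`. It plays
the role of `baseHexagon` for the other parity, and reaches also left subtrees with three nodes. -/
def baseOctagon (v : Tr) : List (Tr × ℕ) :=
  [(nil △ (comb 1 △ (nil △ v)), 4), (comb 2 △ (nil △ v), 6), ((nil △ main 2) △ v, 7),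
    (main 2 △ (nil △ v), 1)]

lemma cyclic_hexagon (z v : Tr) :
    Cyclic (fun e e' => Flip (lo e'.1 e'.2) (up e.1 e.2)) (hexagon z v) := by
  have l1 : lo (nil △ (z △ (nil △ v))) (2 * z.numNodes + 4) =
      false :: true :: false :: (compl (word z) ++ true :: true :: false :: word v) := by
    rw [lo_eq_right (s' := 2 * z.numNodes + 2) (by simp; omega), lo_eq_right (s' := 0) rfl, lo_zero]
    simp
  have u1 : up (nil △ (z △ (nil △ v))) (2 * z.numNodes + 4) =
      false :: true :: false :: (compl (word z) ++ true :: true :: true :: word v) := by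
    rw [up_eq_right (s' := 2 * z.numNodes + 2) (by simp; omega), up_eq_right (s' := 0) rfl, up_zero]
    simp
  have l2 : lo (((z △ nil) △ nil) △ v) (2 * z.numNodes + 5) =
      false :: false :: false :: (compl (word z) ++ true :: true :: true :: word v) := by
    rw [lo_eq_mid (by simp; omega)]
    simp
  have u2 : up (((z △ nil) △ nil) △ v) (2 * z.numNodes + 5) =
      true :: false :: false :: (compl (word z) ++ true :: true :: true :: word v) := by
    rw [up_eq_mid (by simp; omega)]
    simp
  have l3 : lo ((nil △ z) △ (nil △ v)) (2 * z.numNodes + 1) =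
      true :: false :: false :: (compl (word z) ++ true :: true :: false :: word v) := by
    rw [lo_eq_left (s' := 1) (by simp; omega) (by simp; omega), up_eq_mid (by simp)]
    simp
  have u3 : up ((nil △ z) △ (nil △ v)) (2 * z.numNodes + 1) =
      true :: true :: false :: (compl (word z) ++ true :: true :: false :: word v) := by
    rw [up_eq_left (s' := 1) (by simp; omega) (by simp; omega), lo_eq_mid (by simp)]
    simp
  refine ⟨?_, ?_, ?_⟩
  · simp only [l2, u1]
    exact (Flip.head _).cons _
  · simp only [l3, u2]
    exact ((((((Flip.head _).cons _).cons _).append_left _).cons _).cons _).cons _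
  · change Flip (lo _ _) (up _ _)
    simp only [l1, u3]
    exact Flip.head _

lemma cyclic_shiftedHexagon (z v : Tr) :
    Cyclic (fun e e' => Flip (lo e'.1 e'.2) (up e.1 e.2)) (shiftedHexagon z v) := by
  have l1 : lo ((comb 1 △ z) △ (nil △ v)) (2 * z.numNodes + 3) =
      true :: false :: false :: true :: false ::
        (compl (word z) ++ true :: true :: false :: word v) := by
    rw [lo_eq_left (s' := 1) (by simp; omega) (by simp; omega),
      up_eq_left (s' := 1) (by simp) (by simp), show lo (comb 1) 1 = [false, true] by decide]
    simp
  have u1 : up ((comb 1 △ z) △ (nil △ v)) (2 * z.numNodes + 3) =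
      true :: false :: true :: true :: false ::
        (compl (word z) ++ true :: true :: false :: word v) := by
    rw [up_eq_left (s' := 1) (by simp; omega) (by simp; omega),
      lo_eq_left (s' := 1) (by simp) (by simp), show up (comb 1) 1 = [true, true] by decide]
    simp
  have l2 : lo (comb 1 △ (z △ (nil △ v))) (2 * z.numNodes + 6) =
      false :: false :: true :: true :: false ::
        (compl (word z) ++ true :: true :: false :: word v) := by
    rw [lo_eq_right (s' := 2 * z.numNodes + 2) (by simp; omega), lo_eq_right (s' := 0) rfl, lo_zero]
    simp [comb]
  have u2 : up (comb 1 △ (z △ (nil △ v))) (2 * z.numNodes + 6) =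
      false :: false :: true :: true :: false ::
        (compl (word z) ++ true :: true :: true :: word v) := by
    rw [up_eq_right (s' := 2 * z.numNodes + 2) (by simp; omega), up_eq_right (s' := 0) rfl, up_zero]
    simp [comb]
  have l3 : lo (((nil △ (z △ nil)) △ nil) △ v) (2 * z.numNodes + 7) =
      false :: false :: false :: true :: false ::
        (compl (word z) ++ true :: true :: true :: word v) := by
    rw [lo_eq_mid (by simp; omega)]
    simp
  have u3 : up (((nil △ (z △ nil)) △ nil) △ v) (2 * z.numNodes + 7) =
      true :: false :: false :: true :: false ::
        (compl (word z) ++ true :: true :: true :: word v) := by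
    rw [up_eq_mid (by simp; omega)]
    simp
  refine ⟨?_, ?_, ?_⟩
  · simp only [l2, u1]
    exact Flip.head _
  · simp only [l3, u2]
    exact ((Flip.head _).cons _).cons _
  · change Flip (lo _ _) (up _ _)
    simp only [l1, u3]
    exact ((((((((Flip.head _).cons _).cons _).append_left _).cons _).cons _).cons _).cons
      _).cons _

lemma cyclic_baseHexagon (v : Tr) :
    Cyclic (fun e e' => Flip (lo e'.1 e'.2) (up e.1 e.2)) (baseHexagon v) := by
  have l1 : lo (comb 2 △ v) 0 = true :: true :: false :: true :: false :: false :: word v := by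
    rw [lo_zero]; rfl
  have u1 : up (comb 2 △ v) 0 = true :: true :: false :: true :: false :: true :: word v := by
    rw [up_zero]; rfl
  have l2 : lo (main 2 △ v) 3 = true :: false :: false :: true :: false :: true :: word v := by
    rw [lo_eq_left (s' := 1) (by simp) (by simp),
      show up (main 2) 1 = [true, true, false, true] by decide]
    rfl
  have u2 : up (main 2 △ v) 3 = true :: false :: true :: true :: false :: true :: word v := by
    rw [up_eq_left (s' := 1) (by simp) (by simp),
      show lo (main 2) 1 = [true, false, false, true] by decide]
    rfl
  have l3 : lo (nil △ (comb 1 △ v)) 0 =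
      true :: false :: true :: true :: false :: false :: word v := by
    rw [lo_zero]; rfl
  have u3 : up (nil △ (comb 1 △ v)) 0 =
      true :: true :: true :: true :: false :: false :: word v := by
    rw [up_zero]; rfl
  refine ⟨?_, ?_, ?_⟩
  · simp only [l2, u1]
    exact (Flip.head _).cons _
  · simp only [l3, u2]
    exact (((((Flip.head _).cons _).cons _).cons _).cons _).cons _
  · change Flip (lo _ _) (up _ _)
    simp only [l1, u3]
    exact ((Flip.head _).cons _).cons _

lemma cyclic_baseOctagon (v : Tr) :
    Cyclic (fun e e' => Flip (lo e'.1 e'.2) (up e.1 e.2)) (baseOctagon v) := by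
  have l1 : lo (nil △ (comb 1 △ (nil △ v))) 4 =
      false :: true :: true :: false :: false :: true :: true :: false :: word v := by
    rw [lo_eq_right (s' := 2) (by simp), lo_eq_left (s' := 0) (by simp) (by simp),
      show up (comb 1) 0 = [true, true] by decide]
    rfl
  have u1 : up (nil △ (comb 1 △ (nil △ v))) 4 =
      false :: true :: true :: false :: true :: true :: true :: false :: word v := by
    rw [up_eq_right (s' := 2) (by simp), up_eq_left (s' := 0) (by simp) (by simp),
      show lo (comb 1) 0 = [true, false] by decide]
    rfl
  have l2 : lo (comb 2 △ (nil △ v)) 6 =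
      false :: false :: true :: false :: true :: true :: true :: false :: word v := by
    rw [lo_eq_right (s' := 0) (by simp), lo_zero]; rfl
  have u2 : up (comb 2 △ (nil △ v)) 6 =
      false :: false :: true :: false :: true :: true :: true :: true :: word v := by
    rw [up_eq_right (s' := 0) (by simp), up_zero]; rfl
  have l3 : lo ((nil △ main 2) △ v) 7 =
      false :: false :: true :: false :: false :: true :: true :: true :: word v := by
    rw [lo_eq_mid (by simp)]; rfl
  have u3 : up ((nil △ main 2) △ v) 7 =
      true :: false :: true :: false :: false :: true :: true :: true :: word v := by
    rw [up_eq_mid (by simp)]; rfl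
  have l4 : lo (main 2 △ (nil △ v)) 1 =
      true :: false :: true :: false :: false :: true :: true :: false :: word v := by
    rw [lo_eq_left (s' := 3) (by simp) (by simp), show up (main 2) 3 = [true, false, true, true] by decide]
    rfl
  have u4 : up (main 2 △ (nil △ v)) 1 =
      true :: true :: true :: false :: false :: true :: true :: false :: word v := by
    rw [up_eq_left (s' := 3) (by simp) (by simp), show lo (main 2) 3 = [false, false, true, true] by decide]
    rfl
  refine ⟨?_, ?_, ?_, ?_⟩
  · simp only [l2, u1]
    exact (Flip.head _).cons _
  · simp only [l3, u2]
    exact ((((Flip.head _).cons _).cons _).cons _).cons _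
  · simp only [l4, u3]
    exact (((((((Flip.head _).cons _).cons _).cons _).cons _).cons _).cons _).cons _
  · change Flip (lo _ _) (up _ _)
    simp only [l1, u4]
    exact Flip.head _

end Polygons

section Free

lemma rep_congr {v v' : Tr} (h : v.numNodes = v'.numNodes) (h2 : v.numNodes = 2 → v = v') :
    rep v = rep v' := by
  by_cases h' : v.numNodes = 2
  · rw [h2 h']
  · rw [rep_of_ne h', rep_of_ne (by rwa [← h]), h]

lemma combLike_comb (r : ℕ) : CombLike (comb r) := Or.inl (by rw [numNodes_comb])

lemma CombLike.left {t : Tr} (h : CombLike t) : t.left = nil := by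
  rcases h with h | h
  · rw [h]
    cases t.numNodes <;> rfl
  · rw [h]
    rfl

lemma isFree_zero {t : Tr} (h : ¬ CombLike t) : IsFree (t, 0) where
  not_retained := by
    rintro (h' | h' | h' | h' | h')
    · exact h h'.1
    all_goals simp at h'
  right := by simp
  left := by simp

lemma isFree_mid {u v : Tr} {s : ℕ} (hu : 2 ≤ u.numNodes) (hs : s = 2 * u.numNodes + 1) :
    IsFree (u △ v, s) where
  not_retained := by
    rintro (h | h | h | h | h)
    · simp only at h
      omega
    · simp only [BinaryTree.left] at h
      omega
    · simp only at h
      omega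
    · simp only at h
      omega
    · simp only [Prod.mk.injEq, node.injEq] at h
      rw [h.1.2.1] at hu
      simp at hu
  right := by
    simp only [BinaryTree.left]
    omega
  left := by
    simp only [BinaryTree.left]
    omega

/-- Edges over an edge of the path of `u` with an odd index. -/
lemma isFree_left {u v : Tr} {s : ℕ} (hu : 2 ≤ u.numNodes) (hs : s < 2 * u.numNodes)
    (hs2 : s % 2 = 1)
    (h : u.numNodes ≤ 2 ∨ rep v ≠ v ∨ Retained (u, 2 * u.numNodes - s)) : IsFree (u △ v, s) where
  not_retained := by
    rintro (h | h | h | h | h)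
    · simp only at h
      omega
    · simp only [BinaryTree.left] at h
      omega
    · simp only [BinaryTree.left] at h
      rw [h.1] at hu
      simp at hu
    · simp only at h
      omega
    · simp only [Prod.mk.injEq, node.injEq] at h
      rw [h.1.2.1] at hu
      simp at hu
  right := by
    simp only [BinaryTree.left]
    omega
  left := by
    simp only [BinaryTree.left, BinaryTree.right]
    intro _ _ hv
    rcases h with h | h | h
    exacts [Or.inl h, (h hv).elim, Or.inr h]

/-- Edges over a retained edge of the path of `v`. -/
lemma isFree_right {u v : Tr} {s s' : ℕ} (hs : s = 2 * u.numNodes + 2 + s')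
    (hu : u = comb 2 ∨ s' ≠ 0) (h2 : s ≠ 2) (h : Retained (v, s')) : IsFree (u △ v, s) where
  not_retained := by
    rintro (h | h | h | h | h)
    · simp only at h
      omega
    · simp only [BinaryTree.left] at h
      rcases hu with hu | hu
      · exact h.1 hu
      · omega
    · simp only at h
      omega
    · simp only at h
      exact h2 h.2.2.2
    · simp only [Prod.mk.injEq] at h
      omega
  right := by
    simp only [BinaryTree.left, BinaryTree.right]
    intro _
    rw [hs, Nat.add_sub_cancel_left]
    exact Or.inr h
  left := by
    simp only [BinaryTree.left]
    omega

lemma retained_right {z w : Tr} (hz : z ≠ comb 2) (hw : w ≠ nil) (h : CombLike w) :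
    Retained (z △ w, 2 * z.numNodes + 2) := Or.inr (Or.inl ⟨hz, hw, h, rfl⟩)

/-- The last condition rules out a left lift that uses the third edge. -/
lemma isFree_hexagon {z v : Tr} (hz : z ≠ comb 2) (hz1 : 1 ≤ z.numNodes)
    (hv : CombLike (nil △ v)) (h : 3 ≤ z.numNodes ∨ rep (nil △ v) ≠ nil △ v) :
    ∀ e ∈ hexagon z v, IsFree e := by
  simp only [hexagon, List.forall_mem_cons]
  refine ⟨?_, ?_, ?_, by simp⟩
  · exact isFree_right (s' := 2 * z.numNodes + 2) (by simp; omega) (Or.inr (by omega)) (by omega)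
      (retained_right hz (by simp) hv)
  · exact isFree_mid (by simp) (by simp; omega)
  · refine isFree_left (by simpa using hz1) (by simp; omega) (by omega) (Or.inr ?_)
    rcases h with h | h
    · refine Or.inr (Or.inr (Or.inr (Or.inl ⟨rfl, h, ?_⟩)))
      simp
      omega
    · exact Or.inl h

lemma isFree_shiftedHexagon {z v : Tr} (hz : z ≠ comb 2) (hv : CombLike (nil △ v))
    (h : z.numNodes = 0 ∨ rep (nil △ v) ≠ nil △ v) :
    ∀ e ∈ shiftedHexagon z v, IsFree e := by
  simp only [shiftedHexagon, List.forall_mem_cons]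
  refine ⟨?_, ?_, ?_, by simp⟩
  · refine isFree_left (by simp) (by simp; omega) (by omega) ?_
    rcases h with h | h
    · exact Or.inl (by simp [h])
    · exact Or.inr (Or.inl h)
  · exact isFree_right (s' := 2 * z.numNodes + 2) (by simp; omega) (Or.inr (by omega)) (by omega)
      (retained_right hz (by simp) hv)
  · exact isFree_mid (by simp) (by simp; omega)

lemma isFree_baseHexagon {v : Tr} (hv : v ≠ nil) : ∀ e ∈ baseHexagon v, IsFree e := by
  simp only [baseHexagon, List.forall_mem_cons]
  refine ⟨?_, ?_, ?_, by simp⟩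
  · refine isFree_zero fun h => ?_
    have := h.left
    simp [comb] at this
  · exact isFree_left (by simp) (by simp) (by omega) (Or.inl (by simp))
  · refine isFree_zero fun h => ?_
    rcases h with h | h
    · simp [comb] at h
    · simp [main, comb] at h
      exact hv h

lemma isFree_baseOctagon {v : Tr} (hv : CombLike (nil △ v)) : ∀ e ∈ baseOctagon v, IsFree e := by
  simp only [baseOctagon, List.forall_mem_cons]
  refine ⟨?_, ?_, ?_, ?_, by simp⟩
  · exact isFree_right (s' := 2) (by simp) (by simp) (by simp)
      (Or.inr (Or.inr (Or.inr (Or.inl ⟨rfl, by simp, rfl, rfl⟩))))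
  · exact isFree_right (s' := 0) (by simp) (by simp) (by simp) (Or.inl ⟨hv, rfl⟩)
  · exact isFree_mid (by simp) (by simp)
  · exact isFree_left (by simp) (by simp) (by omega) (Or.inl (by simp))

end Free

end OddGraph

namespace OddGraph

open BinaryTree

/-! ### Linking all components -/

section Linking

/-- The polygons in `L` connect the components of the trees `u △ v` with less than `j` nodes in
`u`, except for those with one node in `u`, or with two nodes in `v` unless `v` is a comb. The last
three fields restrict the trees that occur, so that further polygons have new edges and labels. -/
structure IsPartialLinking (n j : ℕ) (L : List (List (Tr × ℕ))) : Prop where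
  chain : LinkChain pairRep n L
  free : ∀ e ∈ L.flatten, IsFree e
  mem_labels : ∀ u v : Tr, u.numNodes + v.numNodes + 1 = n → u.numNodes < j → u.numNodes ≠ 1 →
    (v.numNodes = 2 → v = comb 2) → pairRep (u △ v) ∈ labels pairRep L
  left : ∀ u v s, (u △ v, s) ∈ L.flatten → u.numNodes < j ∧ u.numNodes ≠ 1
  right : ∀ u v s, (u △ v, s) ∈ L.flatten → u ≠ nil → v = comb v.numNodes
  left_right : ∀ z w s, (nil △ (z △ w), s) ∈ L.flatten → z.numNodes + 1 < j

variable {n j : ℕ} {L : List (List (Tr × ℕ))}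

lemma pairRep_ne {u v u' v' : Tr} (h : u.numNodes ≠ u'.numNodes) :
    pairRep (u △ v) ≠ pairRep (u' △ v') := by
  intro h'
  simp only [pairRep_node, node.injEq] at h'
  have := congrArg numNodes h'.2.1
  simp only [numNodes_rep] at this
  exact h this

lemma pairRep_congr {u v u' v' : Tr} (hu : u.numNodes = u'.numNodes)
    (hu2 : u.numNodes = 2 → u = u') (hv : v.numNodes = v'.numNodes)
    (hv2 : v.numNodes = 2 → v = v') : pairRep (u △ v) = pairRep (u' △ v') := by
  rw [pairRep_node, pairRep_node, rep_congr hu hu2, rep_congr hv hv2]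

lemma labels_cons (κ : Tr → Tr) (h : List (Tr × ℕ)) (L : List (List (Tr × ℕ))) :
    labels κ (h :: L) = (h.map fun e => κ e.1) ++ labels κ L := by
  simp [labels]

lemma exists_of_mem_labels (hL : LinkChain pairRep n L) (hn : n ≠ 0) {x : Tr}
    (hx : x ∈ labels pairRep L) :
    ∃ u v s, (u △ v, s) ∈ L.flatten ∧ pairRep (u △ v) = x ∧ u.numNodes + v.numNodes + 1 = n := by
  obtain ⟨⟨t, s⟩, he, h⟩ := mem_labels.1 hx
  have := (hL.order _ he).1
  cases t with
  | nil => exact absurd this.symm hn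
  | node _ u v => exact ⟨u, v, s, he, h, this⟩

lemma IsPartialLinking.not_mem_labels (hL : IsPartialLinking n j L) (hn : n ≠ 0) {u v : Tr}
    (h : j ≤ u.numNodes ∨ u.numNodes = 1) : pairRep (u △ v) ∉ labels pairRep L := by
  intro hx
  obtain ⟨u', v', s, he, h', -⟩ := exists_of_mem_labels hL.chain hn hx
  refine pairRep_ne ?_ h'
  have := hL.left _ _ _ he
  omega

lemma isPartialLinking_baseHexagon (hn : 6 ≤ n) :
    IsPartialLinking n 3 [baseHexagon (comb (n - 3))] where
  chain := by
    refine .cons .empty ⟨?_, by simp [baseHexagon], cyclic_baseHexagon _, ?_, by simp, Or.inl rfl,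
      by simp [labels]⟩
    · simp [baseHexagon]
      omega
    · simp only [baseHexagon, List.map_cons, List.map_nil, List.nodup_cons, List.mem_cons,
        List.not_mem_nil, or_false, not_or, List.nodup_nil, and_true, not_false_eq_true]
      refine ⟨⟨?_, pairRep_ne (by simp)⟩, pairRep_ne (by simp)⟩
      rw [pairRep_node, pairRep_node, rep_of_eq (v := comb 2) (by simp),
        rep_of_eq (v := main 2) (by simp)]
      simp [comb, main]
  free := by
    simpa using isFree_baseHexagon (v := comb (n - 3)) (by
      intro h
      have := congrArg numNodes h
      simp at this
      omega)
  mem_labels := by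
    intro u v h hu hu1 hv
    have : u.numNodes = 0 ∨ u.numNodes = 2 := by omega
    simp only [labels_cons, baseHexagon, List.map_cons, List.map_nil, List.mem_append,
      List.mem_cons]
    rcases this with h0 | h0
    · refine Or.inl (Or.inr (Or.inr (Or.inl (pairRep_congr ?_ ?_ ?_ ?_))))
      · exact h0
      · omega
      · simp
        omega
      · omega
    · rcases eq_of_numNodes_eq_two h0 with rfl | rfl
      · refine Or.inl (Or.inl (pairRep_congr rfl (fun _ => rfl) ?_ ?_))
        · simp
          omega
        · omega
      · refine Or.inl (Or.inr (Or.inl (pairRep_congr rfl (fun _ => rfl) ?_ ?_)))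
        · simp
          omega
        · omega
  left := by
    intro u v s h
    simp only [baseHexagon, List.flatten_cons, List.flatten_nil, List.append_nil, List.mem_cons,
      List.not_mem_nil, or_false, Prod.mk.injEq, node.injEq] at h
    rcases h with ⟨⟨-, rfl, -⟩, -⟩ | ⟨⟨-, rfl, -⟩, -⟩ | ⟨⟨-, rfl, -⟩, -⟩ <;> simp
  right := by
    intro u v s h hu
    simp only [baseHexagon, List.flatten_cons, List.flatten_nil, List.append_nil, List.mem_cons,
      List.not_mem_nil, or_false, Prod.mk.injEq, node.injEq] at h
    rcases h with ⟨⟨-, -, rfl⟩, -⟩ | ⟨⟨-, -, rfl⟩, -⟩ | ⟨⟨-, rfl, -⟩, -⟩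
    · simp
    · simp
    · exact absurd rfl hu
  left_right := by
    intro z w s h
    simp only [baseHexagon, List.flatten_cons, List.flatten_nil, List.append_nil, List.mem_cons,
      List.not_mem_nil, or_false, Prod.mk.injEq, node.injEq] at h
    rcases h with ⟨⟨-, h, -⟩, -⟩ | ⟨⟨-, h, -⟩, -⟩ | ⟨⟨-, -, -, rfl, -⟩, -⟩
    · simp [comb] at h
    · simp [main] at h
    · simp

lemma isPartialLinking_baseOctagon (hn : 6 ≤ n) :
    IsPartialLinking n 4 [baseOctagon (comb (n - 4))] where
  chain := by
    refine .cons .empty ⟨?_, by simp [baseOctagon], cyclic_baseOctagon _, ?_, by simp, Or.inl rfl,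
      by simp [labels]⟩
    · simp [baseOctagon]
      omega
    · simp only [baseOctagon, List.map_cons, List.map_nil, List.nodup_cons, List.mem_cons,
        List.not_mem_nil, or_false, not_or, List.nodup_nil, and_true, not_false_eq_true]
      refine ⟨⟨pairRep_ne (by simp), pairRep_ne (by simp), pairRep_ne (by simp)⟩,
        ⟨pairRep_ne (by simp), ?_⟩, pairRep_ne (by simp)⟩
      rw [pairRep_node, pairRep_node, rep_of_eq (v := comb 2) (by simp),
        rep_of_eq (v := main 2) (by simp)]
      simp [comb, main]
  free := by
    simpa using isFree_baseOctagon (v := comb (n - 4)) (combLike_comb (n - 4 + 1))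
  mem_labels := by
    intro u v h hu hu1 hv
    have : u.numNodes = 0 ∨ u.numNodes = 2 ∨ u.numNodes = 3 := by omega
    simp only [labels_cons, baseOctagon, List.map_cons, List.map_nil, List.mem_append,
      List.mem_cons]
    rcases this with h0 | h0 | h0
    · refine Or.inl (Or.inl (pairRep_congr ?_ ?_ ?_ ?_))
      · exact h0
      · omega
      · simp
        omega
      · omega
    · rcases eq_of_numNodes_eq_two h0 with rfl | rfl
      · refine Or.inl (Or.inr (Or.inl (pairRep_congr rfl (fun _ => rfl) ?_ ?_)))
        · simp
          omega
        · omega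
      · refine Or.inl (Or.inr (Or.inr (Or.inr (Or.inl (pairRep_congr rfl (fun _ => rfl) ?_ ?_)))))
        · simp
          omega
        · omega
    · refine Or.inl (Or.inr (Or.inr (Or.inl (pairRep_congr ?_ ?_ ?_ ?_))))
      · simpa using h0
      · omega
      · simp
        omega
      · intro h2
        rw [hv h2, show n - 4 = 2 by omega]
  left := by
    intro u v s h
    simp only [baseOctagon, List.flatten_cons, List.flatten_nil, List.append_nil, List.mem_cons,
      List.not_mem_nil, or_false, Prod.mk.injEq, node.injEq] at h
    rcases h with ⟨⟨-, rfl, -⟩, -⟩ | ⟨⟨-, rfl, -⟩, -⟩ | ⟨⟨-, rfl, -⟩, -⟩ | ⟨⟨-, rfl, -⟩, -⟩ <;> simp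
  right := by
    intro u v s h hu
    simp only [baseOctagon, List.flatten_cons, List.flatten_nil, List.append_nil, List.mem_cons,
      List.not_mem_nil, or_false, Prod.mk.injEq, node.injEq] at h
    rcases h with ⟨⟨-, rfl, -⟩, -⟩ | ⟨⟨-, -, rfl⟩, -⟩ | ⟨⟨-, -, rfl⟩, -⟩ | ⟨⟨-, -, rfl⟩, -⟩
    · exact absurd rfl hu
    · simp [comb]
    · simp
    · simp [comb]
  left_right := by
    intro z w s h
    simp only [baseOctagon, List.flatten_cons, List.flatten_nil, List.append_nil, List.mem_cons,
      List.not_mem_nil, or_false, Prod.mk.injEq, node.injEq] at h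
    rcases h with ⟨⟨-, -, -, rfl, -⟩, -⟩ | ⟨⟨-, h, -⟩, -⟩ | ⟨⟨-, h, -⟩, -⟩ | ⟨⟨-, h, -⟩, -⟩
    · simp
    · simp [comb] at h
    · simp at h
    · simp [main] at h

lemma comb_ne_main {r : ℕ} (hr : 2 ≤ r) : comb r ≠ main r := by
  intro h
  obtain ⟨s, rfl⟩ := Nat.exists_eq_add_of_le' hr
  simp [comb, main] at h

/-- Two more blocks of components can be linked by a hexagon. -/
lemma IsPartialLinking.cons_hexagon (hL : IsPartialLinking n j L) (hj : 3 ≤ j) (hjn : j + 4 ≤ n) :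
    IsPartialLinking n (j + 2) (hexagon (main (j - 1)) (comb (n - 2 - j)) :: L) where
  chain := by
    refine .cons hL.chain ⟨?_, by simp [hexagon], cyclic_hexagon _ _, ?_, ?_, ?_, ?_⟩
    · simp [hexagon]
      omega
    · simp only [hexagon, List.map_cons, List.map_nil, List.nodup_cons, List.mem_cons,
        List.not_mem_nil, or_false, not_or, List.nodup_nil, and_true, not_false_eq_true]
      exact ⟨⟨pairRep_ne (by simp), pairRep_ne (by simp)⟩, pairRep_ne (by simp)⟩
    · simp only [hexagon, List.head?_cons, Option.mem_def, Option.some.injEq, forall_eq']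
      intro h
      have := hL.left_right _ _ _ h
      simp at this
      omega
    · simp only [hexagon, List.head?_cons, Option.mem_def, Option.some.injEq, forall_eq']
      refine Or.inr (hL.mem_labels _ _ ?_ ?_ ?_ ?_)
      · simp
        omega
      · simp
        omega
      · simp
      · simp
        omega
    · simp only [hexagon, List.tail_cons, List.forall_mem_cons]
      refine ⟨hL.not_mem_labels (by omega) (Or.inl ?_), hL.not_mem_labels (by omega) (Or.inl ?_),
        by simp⟩
      · simp
        omega
      · simp
        omega
  free := by
    intro e he
    rw [List.flatten_cons, List.mem_append] at he
    rcases he with he | he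
    · refine isFree_hexagon ?_ ?_ (combLike_comb (n - 2 - j + 1)) (Or.inr ?_) e he
      · intro h
        have := congrArg numNodes h
        simp only [numNodes_main, numNodes_comb] at this
        rw [this] at h
        exact comb_ne_main le_rfl h.symm
      · simp
        omega
      · change rep (comb (n - 2 - j + 1)) ≠ comb (n - 2 - j + 1)
        rw [rep_of_ne (by simp; omega), numNodes_comb]
        exact (comb_ne_main (by omega)).symm
    · exact hL.free e he
  mem_labels := by
    intro u v h hu hu1 hv
    rw [labels_cons, List.mem_append]
    by_cases hu' : u.numNodes < j
    · exact Or.inr (hL.mem_labels u v h hu' hu1 hv)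
    · have : u.numNodes = j ∨ u.numNodes = j + 1 := by omega
      simp only [hexagon, List.map_cons, List.map_nil, List.mem_cons]
      rcases this with h0 | h0
      · refine Or.inl (Or.inr (Or.inr (Or.inl (pairRep_congr ?_ ?_ ?_ ?_))))
        · simp
          omega
        · omega
        · simp
          omega
        · omega
      · refine Or.inl (Or.inr (Or.inl (pairRep_congr ?_ ?_ ?_ ?_)))
        · simp
          omega
        · omega
        · simp
          omega
        · intro h2
          rw [hv h2, show n - 2 - j = 2 by omega]
  left := by
    intro u v s h
    rw [List.flatten_cons, List.mem_append] at h
    rcases h with h | h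
    · simp only [hexagon, List.mem_cons, List.not_mem_nil, or_false, Prod.mk.injEq,
        node.injEq] at h
      rcases h with ⟨⟨-, rfl, -⟩, -⟩ | ⟨⟨-, rfl, -⟩, -⟩ | ⟨⟨-, rfl, -⟩, -⟩ <;> simp <;> omega
    · have := hL.left u v s h
      omega
  right := by
    intro u v s h hu
    rw [List.flatten_cons, List.mem_append] at h
    rcases h with h | h
    · simp only [hexagon, List.mem_cons, List.not_mem_nil, or_false, Prod.mk.injEq,
        node.injEq] at h
      rcases h with ⟨⟨-, rfl, -⟩, -⟩ | ⟨⟨-, -, rfl⟩, -⟩ | ⟨⟨-, -, rfl⟩, -⟩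
      · exact absurd rfl hu
      · simp
      · simp [comb]
    · exact hL.right u v s h hu
  left_right := by
    intro z w s h
    rw [List.flatten_cons, List.mem_append] at h
    rcases h with h | h
    · simp only [hexagon, List.mem_cons, List.not_mem_nil, or_false, Prod.mk.injEq,
        node.injEq] at h
      rcases h with ⟨⟨-, -, -, rfl, -⟩, -⟩ | ⟨⟨-, h, -⟩, -⟩ | ⟨⟨-, h, -⟩, -⟩
      · simp
      · simp at h
      · simp at h
    · have := hL.left_right z w s h
      omega

lemma exists_isPartialLinking (hn : 6 ≤ n) : ∃ L, IsPartialLinking n (n - 2) L := by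
  have key : ∀ j₀ L₀, 3 ≤ j₀ → IsPartialLinking n j₀ L₀ → ∀ m, j₀ + 2 * m ≤ n - 2 →
      ∃ L, IsPartialLinking n (j₀ + 2 * m) L := by
    intro j₀ L₀ hj h₀ m
    induction m with
    | zero => exact fun _ => ⟨L₀, h₀⟩
    | succ m ih =>
      intro hm
      obtain ⟨L, hL⟩ := ih (by omega)
      exact ⟨_, hL.cons_hexagon (by omega) (by omega)⟩
  -- `baseOctagon` starts one block later than `baseHexagon`, which settles the parity.
  rcases Nat.even_or_odd' n with ⟨m, rfl | rfl⟩
  · have := key 4 _ (by omega) (isPartialLinking_baseOctagon hn) (m - 3) (by omega)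
    rwa [show 4 + 2 * (m - 3) = 2 * m - 2 by omega] at this
  · have := key 3 _ le_rfl (isPartialLinking_baseHexagon hn) (m - 2) (by omega)
    rwa [show 3 + 2 * (m - 2) = 2 * m + 1 - 2 by omega] at this

lemma LinkChain.cons_shiftedHexagon (hn : 6 ≤ n) (hL : IsPartialLinking n (n - 2) L) :
    LinkChain pairRep n (shiftedHexagon (main (n - 6)) (main 2) :: L) := by
  refine .cons hL.chain ⟨?_, by simp [shiftedHexagon], cyclic_shiftedHexagon _ _, ?_, ?_, ?_, ?_⟩
  · simp [shiftedHexagon]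
    omega
  · simp only [shiftedHexagon, List.map_cons, List.map_nil, List.nodup_cons, List.mem_cons,
      List.not_mem_nil, or_false, not_or, List.nodup_nil, and_true, not_false_eq_true]
    exact ⟨⟨pairRep_ne (by simp), pairRep_ne (by simp; omega)⟩, pairRep_ne (by simp)⟩
  · simp only [shiftedHexagon, List.head?_cons, Option.mem_def, Option.some.injEq, forall_eq']
    intro h
    exact absurd (hL.right _ _ _ h (by simp)) (by decide)
  · simp only [shiftedHexagon, List.head?_cons, Option.mem_def, Option.some.injEq, forall_eq']
    refine Or.inr (hL.mem_labels _ _ ?_ ?_ ?_ ?_)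
    · simp
      omega
    · simp
      omega
    · simp
    · simp
  · simp only [shiftedHexagon, List.tail_cons, List.forall_mem_cons]
    refine ⟨hL.not_mem_labels (by omega) (Or.inr (by simp)), ?_, by simp⟩
    intro hx
    obtain ⟨u, v, s, he, h, h'⟩ := exists_of_mem_labels hL.chain (by omega) hx
    simp only [pairRep_node, node.injEq] at h
    have h1 := congrArg numNodes h.2.1
    have h2 := congrArg numNodes h.2.2
    simp only [numNodes_rep, numNodes_node, numNodes_main] at h1 h2
    have hv := hL.right _ _ _ he (by rintro rfl; simp at h1)
    rw [h2] at hv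
    have h3 := h.2.2
    rw [hv, rep_of_eq (by simp), rep_of_eq (by simp)] at h3
    exact comb_ne_main le_rfl h3

/-- The links for six or more nodes. A partial linking leaves four components: left subtrees with one
node and the remaining class with two nodes in the right subtree are attached by `shiftedHexagon`,
left subtrees with `n - 2` and `n - 1` nodes by a last hexagon, which can be chosen in several
ways. -/
lemma exists_isLinking (hn : 6 ≤ n) : ∃ L, ∀ z : Tr, z.numNodes = n - 3 →
    IsLinking n (hexagon z nil :: L) ∧
    (nil △ (z △ comb 1), 2 * z.numNodes + 4) ∉ L.flatten := by
  obtain ⟨L, hL⟩ := exists_isPartialLinking hn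
  have hL' := LinkChain.cons_shiftedHexagon hn hL
  refine ⟨shiftedHexagon (main (n - 6)) (main 2) :: L, fun z hz => ?_⟩
  have hhead : (nil △ (z △ comb 1), 2 * z.numNodes + 4) ∉
      (shiftedHexagon (main (n - 6)) (main 2) :: L).flatten := by
    rw [List.flatten_cons, List.mem_append]
    rintro (h | h)
    · simp only [shiftedHexagon, List.mem_cons, List.not_mem_nil, or_false, Prod.mk.injEq,
        node.injEq] at h
      rcases h with ⟨⟨-, h, -⟩, -⟩ | ⟨⟨-, h, -⟩, -⟩ | ⟨⟨-, h, -⟩, -⟩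
      · simp at h
      · simp [comb] at h
      · simp at h
    · have := hL.left_right z _ _ h
      omega
  have htail : ∀ u v : Tr, n - 2 ≤ u.numNodes → pairRep (u △ v) ∉
      labels pairRep (shiftedHexagon (main (n - 6)) (main 2) :: L) := by
    intro u v hu
    rw [labels_cons, List.mem_append, not_or]
    refine ⟨?_, hL.not_mem_labels (by omega) (Or.inl hu)⟩
    simp only [shiftedHexagon, List.map_cons, List.map_nil, List.mem_cons, List.not_mem_nil,
      or_false, not_or]
    refine ⟨pairRep_ne ?_, pairRep_ne ?_, pairRep_ne ?_⟩
    · simp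
      omega
    · simp
      omega
    · simp
      omega
  refine ⟨⟨?_, ?_, ?_⟩, hhead⟩
  · refine .cons hL' ⟨?_, by simp [hexagon], cyclic_hexagon _ _, ?_, ?_, ?_, ?_⟩
    · simp [hexagon]
      omega
    · simp only [hexagon, List.map_cons, List.map_nil, List.nodup_cons, List.mem_cons,
        List.not_mem_nil, or_false, not_or, List.nodup_nil, and_true, not_false_eq_true]
      exact ⟨⟨pairRep_ne (by simp), pairRep_ne (by simp)⟩, pairRep_ne (by simp)⟩
    · simp only [hexagon, List.head?_cons, Option.mem_def, Option.some.injEq, forall_eq']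
      exact hhead
    · simp only [hexagon, List.head?_cons, Option.mem_def, Option.some.injEq, forall_eq']
      right
      rw [labels_cons, List.mem_append]
      refine Or.inr (hL.mem_labels _ _ ?_ ?_ ?_ ?_)
      · simp
        omega
      · simp
        omega
      · simp
      · simp
        omega
    · simp only [hexagon, List.tail_cons, List.forall_mem_cons]
      refine ⟨htail _ _ ?_, htail _ _ ?_, by simp⟩
      · simp
        omega
      · simp
        omega
  · intro t ht
    obtain ⟨u, v, rfl, h⟩ := exists_node (n := n - 1) (t := t) (by omega)
    rw [labels_cons, labels_cons, List.mem_append, List.mem_append]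
    simp only [hexagon, shiftedHexagon, List.map_cons, List.map_nil, List.mem_cons]
    by_cases h1 : u.numNodes = n - 2
    · refine Or.inl (Or.inr (Or.inr (Or.inl (pairRep_congr ?_ ?_ ?_ ?_))))
      · simp
        omega
      · omega
      · simp
        omega
      · omega
    by_cases h2 : u.numNodes = n - 1
    · refine Or.inl (Or.inr (Or.inl (pairRep_congr ?_ ?_ ?_ ?_)))
      · simp
        omega
      · omega
      · simp
        omega
      · omega
    by_cases h3 : u.numNodes = 1
    · refine Or.inr (Or.inl (Or.inr (Or.inl (pairRep_congr ?_ ?_ ?_ ?_))))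
      · simp
        omega
      · omega
      · simp
        omega
      · omega
    by_cases h4 : v = main 2
    · subst h4
      refine Or.inr (Or.inl (Or.inr (Or.inr (Or.inl (pairRep_congr ?_ ?_ rfl fun _ => rfl)))))
      · simp at h ⊢
        omega
      · simp at h
        omega
    · refine Or.inr (Or.inr (hL.mem_labels u v (by omega) (by omega) h3 fun hv => ?_))
      exact (eq_of_numNodes_eq_two hv).resolve_right h4
  · intro e he
    rw [List.flatten_cons, List.flatten_cons, List.mem_append, List.mem_append] at he
    rcases he with he | he | he
    · refine isFree_hexagon ?_ (by omega) (combLike_comb 1) (Or.inl (by omega)) e he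
      rintro rfl
      simp at hz
      omega
    · refine isFree_shiftedHexagon ?_ (Or.inr rfl) (Or.inr (by decide)) e he
      intro h
      have := congrArg numNodes h
      simp only [numNodes_main, numNodes_comb] at this
      rw [this] at h
      exact comb_ne_main le_rfl h.symm
    · exact hL.free e he

/-- The links for five nodes, where left and right subtrees with two nodes occur together. -/
def links₅ : List (List (Tr × ℕ)) :=
  [shiftedHexagon (comb 1) nil, baseOctagon (comb 1), baseHexagon (main 2)]

lemma isLinking₅ : IsLinking 5 links₅ where
  chain := by
    refine .cons (.cons (.cons .empty ?_) ?_) ?_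
    · exact ⟨by decide, by decide, cyclic_baseHexagon _, by decide, by decide, by decide, by decide⟩
    · exact ⟨by decide, by decide, cyclic_baseOctagon _, by decide, by decide, by decide, by decide⟩
    · exact ⟨by decide, by decide, cyclic_shiftedHexagon _ _, by decide, by decide, by decide,
        by decide⟩
  mem_labels := by
    intro t ht
    obtain ⟨u, v, rfl, h⟩ := exists_node ht
    have k : main 0 △ main 4 ∈ labels pairRep links₅ ∧ main 1 △ main 3 ∈ labels pairRep links₅ ∧
      main 3 △ main 1 ∈ labels pairRep links₅ ∧ main 4 △ main 0 ∈ labels pairRep links₅ := by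
      decide
    have k2 : ∀ u ∈ [comb 2, main 2], ∀ v ∈ [comb 2, main 2], u △ v ∈ labels pairRep links₅ := by
      decide
    rw [pairRep_node]
    by_cases hu : u.numNodes = 2
    · rw [rep_of_eq hu, rep_of_eq (by omega)]
      exact k2 u (by simpa using eq_of_numNodes_eq_two hu) v
        (by simpa using eq_of_numNodes_eq_two (t := v) (by omega))
    · rw [rep_of_ne hu, rep_of_ne (by omega), show v.numNodes = 4 - u.numNodes by omega]
      have : u.numNodes = 0 ∨ u.numNodes = 1 ∨ u.numNodes = 3 ∨ u.numNodes = 4 := by omega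
      rcases this with h0 | h0 | h0 | h0 <;> rw [h0]
      exacts [k.1, k.2.1, k.2.2.1, k.2.2.2]
  free := by
    have key : ∀ e ∈ links₅.flatten, ¬ Retained e ∧ (2 * e.1.left.numNodes + 2 ≤ e.2 →
        e.1.right.numNodes ≤ 2 ∨ Retained (e.1.right, e.2 - (2 * e.1.left.numNodes + 2))) ∧
        (1 ≤ e.2 → e.2 ≤ 2 * e.1.left.numNodes → rep e.1.right = e.1.right →
        e.1.left.numNodes ≤ 2 ∨ Retained (e.1.left, 2 * e.1.left.numNodes - e.2)) := by
      decide
    exact fun e he => ⟨(key e he).1, (key e he).2.1, (key e he).2.2⟩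

/-- The recursion starts with three, four and, with special links, five nodes. -/
lemma exists_isGood (n : ℕ) : ∃ P, IsGood n P := by
  induction n using Nat.strong_induction_on with
  | _ n ih =>
    have step : ∀ L, 5 ≤ n → IsLinking n L → ∃ P, IsGood n P := by
      intro L hn hL
      choose! P hP using ih
      exact ⟨_, hL.isGood (by omega) (PV := fun u => P (n - 1 - u.numNodes))
        (PU := fun v => P (n - 1 - v.numNodes)) (fun u hu => hP _ (by omega))
        fun v hv => hP _ (by omega)⟩
    rcases le_or_gt n 2 with h | h
    · exact ⟨_, isGood_empty h⟩
    rcases le_or_gt 6 n with h6 | h6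
    · obtain ⟨L, hL⟩ := exists_isLinking h6
      exact step _ (by omega) (hL (main (n - 3)) (by simp)).1
    have : n = 3 ∨ n = 4 ∨ n = 5 := by omega
    rcases this with rfl | rfl | rfl
    exacts [⟨_, isGood₃⟩, ⟨_, isGood₄⟩, step _ le_rfl isLinking₅]

end Linking

end OddGraph

namespace OddGraph

open BinaryTree

/-! ### Counting schemes -/

section Counting

variable {n : ℕ} {PV PU : Tr → Set (List (Tr × ℕ))} {L : List (List (Tr × ℕ))}

lemma liftRight_nil_mem_used_lifts (hn : 0 < n) {e : Tr × ℕ} :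
    liftRight nil e ∈ used (lifts n PV PU) ↔ e ∈ used (PV nil) := by
  rw [mem_used_lifts]
  constructor
  · rintro (⟨u, hu, e', he', h⟩ | ⟨v, hv, hv', e', he', h⟩)
    · simp only [liftRight, Prod.mk.injEq, node.injEq] at h
      obtain ⟨⟨-, rfl, h1⟩, h2⟩ := h
      obtain rfl : e = e' := Prod.ext h1 (by omega)
      exact he'
    · simp only [liftRight, liftLeft, Prod.mk.injEq, node.injEq] at h
      obtain ⟨⟨-, h1, -⟩, h2⟩ := h
      rw [← h1] at h2
      omega
  · exact fun he => Or.inl ⟨nil, hn, e, he, rfl⟩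

lemma liftLeft_nil_mem_used_lifts (hn : 0 < n)
    (hPU : ∀ v : Tr, v.numNodes < n → IsGood (n - 1 - v.numNodes) (PU v)) {e : Tr × ℕ} :
    e.2 < 2 * e.1.numNodes ∧ liftLeft nil e ∈ used (lifts n PV PU) ↔ e ∈ used (PU nil) := by
  rw [mem_used_lifts]
  constructor
  · rintro ⟨h0, ⟨u, hu, e', he', h⟩ | ⟨v, hv, hv', e', he', h⟩⟩
    · simp only [liftRight, liftLeft, Prod.mk.injEq, node.injEq] at h
      obtain ⟨⟨-, h1, -⟩, h2⟩ := h
      rw [h1] at h2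
      omega
    · have o := (hPU v hv).scheme.lt_of_mem_used he'
      simp only [liftLeft, Prod.mk.injEq, node.injEq] at h
      obtain ⟨⟨-, h1, rfl⟩, h2⟩ := h
      obtain rfl : e = e' := Prod.ext h1 (by rw [← h1] at o h2; omega)
      exact he'
  · intro he
    have o := (hPU nil hn).scheme.lt_of_mem_used he
    exact ⟨by omega, Or.inr ⟨nil, hn, rfl, e, he, rfl⟩⟩

lemma IsLinking.mem_used_sdiff (hL : IsLinking n L)
    (hPV : ∀ u : Tr, u.numNodes < n → IsGood (n - 1 - u.numNodes) (PV u))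
    (hPU : ∀ v : Tr, v.numNodes < n → IsGood (n - 1 - v.numNodes) (PU v)) (e : Tr × ℕ) :
    e ∈ used (lifts n PV PU ∪ {h | h ∈ L}) \ {e | e ∈ L.flatten} ↔ e ∈ used (lifts n PV PU) := by
  rw [used_union, used_setOf_mem]
  constructor
  · rintro ⟨h1 | h1, h2⟩
    exacts [h1, (h2 h1).elim]
  · exact fun h => ⟨Or.inl h, fun h' => hL.not_mem_used hPV hPU e h' h⟩

/-- In each step of the recursion the schemes for `nil △ v` and for `u △ nil` can be chosen
independently, so that the number of schemes is at least squared. -/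
theorem exists_many_isGood (hn : 6 ≤ n) : ∃ S : Finset (Set (Tr × ℕ)), 2 ^ 2 ^ (n - 6) ≤ S.card ∧
    ∀ E ∈ S, ∃ P, IsGood n P ∧ used P = E := by
  classical
  choose D hD using exists_isGood
  induction n, hn using Nat.le_induction with
  | base =>
    obtain ⟨L, hL⟩ := exists_isLinking (n := 6) le_rfl
    set F : Tr → Set (List (Tr × ℕ)) := fun u => D (6 - 1 - u.numNodes) with hF
    set P : Tr → Set (List (Tr × ℕ)) := fun z => lifts 6 F F ∪ {h | h ∈ hexagon z nil :: L} with hP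
    have hgood : ∀ z : Tr, z.numNodes = 3 → IsGood 6 (P z) := fun z hz =>
      (hL z hz).1.isGood (by omega) (fun u _ => hD _) fun v _ => hD _
    have hne : used (P (comb 3)) ≠ used (P (main 3)) := by
      intro h
      set e : Tr × ℕ := (nil △ (comb 3 △ comb 1), 10) with he
      have h1 : e ∈ used (P (comb 3)) := ⟨_, Or.inr (List.mem_cons_self ..), List.mem_cons_self ..⟩
      have hL1 := hL (comb 3) (by simp)
      have h2 := hL1.1.not_mem_used (PV := F) (PU := F) (fun u _ => hD _) (fun v _ => hD _) e
        (by simp [hexagon, he, comb])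
      rw [h, hP, used_union, used_setOf_mem] at h1
      rcases h1 with h1 | h1
      · exact h2 h1
      · rw [Set.mem_ofPred_eq, List.flatten_cons, List.mem_append] at h1
        rcases h1 with h1 | h1
        · revert h1
          decide
        · exact hL1.2 h1
    refine ⟨{used (P (comb 3)), used (P (main 3))}, ?_, ?_⟩
    · rw [Finset.card_pair hne]
      norm_num
    · intro E hE
      rw [Finset.mem_insert, Finset.mem_singleton] at hE
      rcases hE with rfl | rfl
      exacts [⟨_, hgood _ (by simp), rfl⟩, ⟨_, hgood _ (by simp), rfl⟩]
  | succ n hn ih =>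
    obtain ⟨S, hS, hS'⟩ := ih
    choose! Q hQ hQ' using hS'
    obtain ⟨L, hL⟩ := exists_isLinking (n := n + 1) (by omega)
    have hL := (hL (main (n + 1 - 3)) (by simp)).1
    set F : Set (Tr × ℕ) → Tr → Set (List (Tr × ℕ)) := fun E u =>
      if u = nil then Q E else D (n + 1 - 1 - u.numNodes) with hF
    have hFgood : ∀ E ∈ S, ∀ u : Tr, u.numNodes < n + 1 →
        IsGood (n + 1 - 1 - u.numNodes) (F E u) := by
      intro E hE u _
      simp only [hF]
      split_ifs with h
      · rw [h]
        exact hQ E hE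
      · exact hD _
    set G : Set (Tr × ℕ) × Set (Tr × ℕ) → Set (List (Tr × ℕ)) := fun E =>
      lifts (n + 1) (F E.1) (F E.2) ∪ {h | h ∈ hexagon (main (n + 1 - 3)) nil :: L} with hG
    refine ⟨(S ×ˢ S).image fun E => used (G E), ?_, ?_⟩
    · rw [Finset.card_image_of_injOn, Finset.card_product,
        show n + 1 - 6 = n - 6 + 1 by omega, pow_succ, pow_mul, sq]
      · exact Nat.mul_le_mul hS hS
      · rintro ⟨E₁, E₂⟩ hE ⟨E₁', E₂'⟩ hE' h
        simp only [Finset.coe_product, Set.mem_prod, Finset.mem_coe] at hE hE'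
        have key : ∀ e, e ∈ used (lifts (n + 1) (F E₁) (F E₂)) ↔
            e ∈ used (lifts (n + 1) (F E₁') (F E₂')) := by
          intro e
          rw [← hL.mem_used_sdiff (hFgood _ hE.1) (hFgood _ hE.2),
            ← hL.mem_used_sdiff (hFgood _ hE'.1) (hFgood _ hE'.2)]
          simp only [hG] at h
          rw [h]
        have hFnil : ∀ E ∈ S, used (F E nil) = E := by
          intro E hE
          simp only [hF, if_true]
          exact hQ' E hE
        refine Prod.ext ?_ ?_
        · rw [← hFnil _ hE.1, ← hFnil _ hE'.1]
          ext e
          rw [← liftRight_nil_mem_used_lifts (n := n + 1) (PU := F E₂) (by omega), key,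
            liftRight_nil_mem_used_lifts (by omega)]
        · rw [← hFnil _ hE.2, ← hFnil _ hE'.2]
          ext e
          rw [← liftLeft_nil_mem_used_lifts (n := n + 1) (PV := F E₁) (by omega) (hFgood _ hE.2),
            key, liftLeft_nil_mem_used_lifts (by omega) (hFgood _ hE'.2)]
    · intro E hE
      obtain ⟨⟨E₁, E₂⟩, hE', rfl⟩ := Finset.mem_image.1 hE
      rw [Finset.mem_product] at hE'
      exact ⟨_, hL.isGood (by omega) (hFgood _ hE'.1) (hFgood _ hE'.2), rfl⟩

/-- The Hamilton cycles obtained from different schemes are different. -/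
theorem le_ncard_hamiltonCycles (k : ℕ) (hk : 6 ≤ k) :
    2 ^ 2 ^ (k - 6) ≤ (oddGraph k).hamiltonCycles.ncard := by
  obtain ⟨S, hS, hS'⟩ := exists_many_isGood hk
  choose! P hP hP' using hS'
  have hC : ∀ E ∈ S, ∃ C ∈ (oddGraph k).hamiltonCycles, ∀ e : Tr × ℕ, e.1.numNodes = k →
      e.2 < 2 * k → (pathEdge k e ∈ C ↔ e ∉ E) := by
    intro E hE
    obtain ⟨C, h1, h2⟩ := (hP E hE).scheme.exists_hamiltonCycle (by omega)
      ((hP E hE).connects (by omega))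
    exact ⟨C, h1, by rwa [hP' E hE] at h2⟩
  choose! C hC hC' using hC
  have hinj : Set.InjOn C S := by
    intro E hE E' hE' h
    have hlt : ∀ E ∈ S, ∀ e ∈ E, e.1.numNodes = k ∧ e.2 < 2 * k := by
      intro E hE e he
      rw [← hP' E hE] at he
      exact (hP E hE).scheme.lt_of_mem_used he
    ext e
    constructor
    · intro he
      have h0 := hlt E hE e he
      by_contra hn
      have := (hC' E' hE' e h0.1 h0.2).2 hn
      rw [← h] at this
      exact (hC' E hE e h0.1 h0.2).1 this he
    · intro he
      have h0 := hlt E' hE' e he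
      by_contra hn
      have := (hC' E hE e h0.1 h0.2).2 hn
      rw [h] at this
      exact (hC' E' hE' e h0.1 h0.2).1 this he
  refine hS.trans ?_
  rw [← Set.ncard_coe_finset, ← hinj.ncard_image]
  refine Set.ncard_le_ncard ?_ (Set.toFinite _)
  rintro _ ⟨E, hE, rfl⟩
  exact hC E hE

end Counting

end OddGraph

theorem theorem3 (k : ℕ) (hk : 6 ≤ k) :
    2 ^ 2 ^ (k - 6) ≤ (oddGraph k).hamiltonCycles.ncard := by
  exact OddGraph.le_ncard_hamiltonCycles k hk
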